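/- Let $q\ge 2$ be an integer and, for $n\ge 0$, let $S_q(n)$ be the sum of the digits of $n$ in base $q$. For real $c,x$ and $N\ge 1$ put $$\sigma_N^{(c)}(x)=\sum_{n=0}^{N-1}e^{2\pi i c S_q(n)}e^{2\pi i n x}.$$ Let the Gelfond exponent $\gamma(c)=\gamma(q;c)$ be the infimum of all real $\gamma$ such that $\sup_{x\in\mathbb R}|\sigma_N^{(c)}(x)|=O(N^{\gamma})$ as $N\to\infty$. Let $\mathbb T=\mathbb R/\mathbb Z$, $Tx=qx \bmod 1$, and $$f_c(x)=\log\left|\frac{\sin \pi q(x+c)}{\sin \pi (x+c)}\right|\in[-\infty,\log q]$$ (with $f_c(x)=\log q$ where $x+c\in\mathbb Z$, and $f_c(x)=-\infty$ at the other zeros of the numerator), and let $$\beta(c)=\sup_{\mu}\int_{\mathbb T} f_c\,d\mu,$$ the supremum being over all $T$-invariant Borel probability measures $\mu$ on $\mathbb T$, where the integrals take values in $[-\infty,\log q]$. Then $\gamma(c)=\beta(c)/\log q$ for every $c\in\mathbb R$, and there is a constant $C>0$, depending only on $q$, such that for all $c\in\mathbb R$, all $x\in\mathbb R$ and all integers $N\ge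 1$, $$\left|\sum_{n=0}^{N-1}e^{2\pi i c S_q(n)}e^{2\pi i n x}\right|\le C\,N^{\gamma(c)}.$$ -/

import Mathlib

open MeasureTheory Filter
open scoped ENNReal

noncomputable section

namespace ThueMorse

/-- The sum of the digits of `n` in base `q`. -/
def digitSum (q n : ℕ) : ℕ := (Nat.digits q n).sum

/-- The generalized Thue-Morse sequence `t_n = exp (2 π i c S_q(n))`. -/
def thueMorse (q : ℕ) (c : ℝ) (n : ℕ) : ℂ :=
  Complex.exp (2 * Real.pi * Complex.I * c * (digitSum q n : ℂ))

/-- The generalized Thue-Morse trigonometric polynomial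
`σ_N(x) = ∑_{n < N} t_n exp (2 π i n x)`. -/
def sigma (q : ℕ) (c : ℝ) (N : ℕ) (x : ℝ) : ℂ :=
  ∑ n ∈ Finset.range N, thueMorse q c n * Complex.exp (2 * Real.pi * Complex.I * (n : ℂ) * x)

/-- The Gelfond exponent: the infimum of all real `γ` with `sup_x |σ_N(x)| = O(N ^ γ)`.
(The trivial bound `|σ_N(x)| ≤ N` makes every supremum finite and puts `γ = 1` in the set.) -/
def gelfondExponent (q : ℕ) (c : ℝ) : ℝ :=
  sInf {γ : ℝ | (fun N : ℕ => ⨆ x : ℝ, ‖sigma q c N x‖) =O[atTop] (fun N : ℕ => (N : ℝ) ^ γ)}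

/-- The function `|sin (π q (x + c)) / sin (π (x + c))|`, extended by continuity, i.e. by the
value `q`, to the points where the denominator vanishes. -/
def phi (q : ℕ) (c x : ℝ) : ℝ :=
  if Real.sin (Real.pi * (x + c)) = 0 then (q : ℝ)
  else |Real.sin (Real.pi * q * (x + c)) / Real.sin (Real.pi * (x + c))|

theorem phi_periodic (q : ℕ) (c : ℝ) : Function.Periodic (phi q c) 1 := by
  intro x
  have h1 : Real.sin (Real.pi * (x + 1 + c)) = -Real.sin (Real.pi * (x + c)) := by
    rw [← Real.sin_add_pi]; congr 1; ring
  have h2 : Real.sin (Real.pi * q * (x + 1 + c))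
      = (-1) ^ q * Real.sin (Real.pi * q * (x + c)) := by
    rw [← Real.sin_add_nat_mul_pi]; congr 1; ring
  unfold phi
  rw [h1, h2]
  simp [abs_div, abs_mul]

/-- The function `f_c = log |sin (π q (x + c)) / sin (π (x + c))|` on the circle `ℝ / ℤ`, with
values in `[-∞, log q]` and with value `-∞` where the quotient vanishes. -/
def logPhi (q : ℕ) (c : ℝ) (x : UnitAddCircle) : EReal :=
  ENNReal.log (ENNReal.ofReal ((phi_periodic q c).lift x))

/-- The integral of an extended-real function whose positive part has a finite integral: the
integral of the positive part minus the integral of the negative part, with values in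
`[-∞, ∞)`. -/
def extIntegral (μ : Measure UnitAddCircle) (f : UnitAddCircle → EReal) : EReal :=
  ((∫⁻ x, (f x).toENNReal ∂μ : ℝ≥0∞) : EReal) - ((∫⁻ x, (-f x).toENNReal ∂μ : ℝ≥0∞) : EReal)

/-- The Borel probability measures on the circle `ℝ / ℤ` that are invariant under
`T x = q x`. -/
def invariantMeasures (q : ℕ) : Set (ProbabilityMeasure UnitAddCircle) :=
  {μ | MeasurePreserving (fun x : UnitAddCircle => q • x)
    (μ : Measure UnitAddCircle) (μ : Measure UnitAddCircle)}

/-- `β(c)`, the supremum of the integrals of `f_c` over all `T`-invariant Borel probability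
measures. -/
def beta (q : ℕ) (c : ℝ) : EReal :=
  ⨆ μ ∈ invariantMeasures q, extIntegral (μ : Measure UnitAddCircle) (logPhi q c)

end ThueMorse

end

/-!
Write `φ = phi q c` and `P_n(x) = φ(x) φ(qx) ⋯ φ(q^(n-1) x)`. Splitting off last digits gives
`|σ_{q^n}(x)| = P_n(x)` (`norm_sigma_pow`) and bounds `|σ_N(x)|` by `q` times the sum of the
`P_k(x)` with `q^k ≤ N` (`norm_sigma_le_sum_orbitProd`). So everything reduces to showing that
`max P_n` equals `exp (n β(c))` up to a factor that depends only on `q`.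

The lower bound `exp (n β(c)) ≤ max P_n` is the integration of a Birkhoff sum against an invariant
measure (`beta_le`). For the upper bound it suffices to find a periodic orbit along which the
product of `φ` is comparable with `max P_n`, because such an orbit carries an invariant measure
(`le_beta_of_periodic`). There are two cases.

* `(q - 1) c` is not close to an integer (`exists_le_beta_of_far`). Let `y` maximize `P_n` and let
  `N = q^n - 1`. The points `w` with `q^n w ∈ w + b + ℤ / q` have spacing `1 / (q N)`, so one of
  them has distance at most `1 / (2 q N)` from `y`, and Bernstein's inequality for trigonometric
  polynomials with frequencies in `[-N/2, N/2]` gives `P_n(w) ≥ (1 - π/4) max P_n`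
  (`norm_mul_eval_derivative_sub_le`, `norm_sigma_sub_le`). If `q^2 b ∈ ℤ`, then `q^2 w` is
  periodic, and `P_n(q^2 w)` differs from `P_n(w)` by the factor `P_2(q^n w) / P_2(w)`. A suitable
  choice of `b` keeps this factor away from `0` (`exists_shift_orbitProd`); this uses that `y` and
  `q y` are not both close to the maximum of `φ`.

* `(q - 1) c` is close to an integer (`exists_le_beta_of_near`). Then some fixed point of
  `x ↦ q x` is close to the maximum of `φ`, and it is maximizing: `log φ` minus its value at the
  fixed point is dominated by the coboundary of a sawtooth function
  (`exists_phi_add_le_mul_exp`). Near the fixed point this is the concavity of the kernel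
  `sin (π q t) / sin (π t)`, and far from it `φ` is smaller than `q` by a definite amount.

Finally `P_n` is at least `(4/π)^n` somewhere, so `exp β(c) ≥ 4/π` for every `c`, and the sum of
the `P_k` is dominated by a geometric sum with uniform constants.
-/

noncomputable section

namespace ThueMorse

/-! ### The product formula -/

/-- The additive character `t ↦ exp (2 π i t)` of `ℝ`. -/
def expTwoPi (t : ℝ) : ℂ := Complex.exp (2 * Real.pi * Complex.I * t)

theorem expTwoPi_add (s t : ℝ) : expTwoPi (s + t) = expTwoPi s * expTwoPi t := by
  unfold expTwoPi
  rw [← Complex.exp_add]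
  push_cast
  ring_nf

theorem expTwoPi_nat_mul (n : ℕ) (t : ℝ) : expTwoPi (n * t) = expTwoPi t ^ n := by
  unfold expTwoPi
  rw [← Complex.exp_nat_mul]
  push_cast
  ring_nf

@[simp]
theorem norm_expTwoPi (t : ℝ) : ‖expTwoPi t‖ = 1 := by
  have : (2 * Real.pi * Complex.I * t : ℂ) = ((2 * Real.pi * t : ℝ) : ℂ) * Complex.I := by
    push_cast; ring
  rw [expTwoPi, this, Complex.norm_exp_ofReal_mul_I]

theorem norm_expTwoPi_sub_one (t : ℝ) : ‖expTwoPi t - 1‖ = 2 * |Real.sin (Real.pi * t)| := by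
  have : (2 * Real.pi * Complex.I * t : ℂ) = Complex.I * ((2 * Real.pi * t : ℝ) : ℂ) := by
    push_cast; ring
  rw [expTwoPi, this, Complex.norm_exp_I_mul_ofReal_sub_one, Real.norm_eq_abs, abs_mul,
    abs_of_pos (by norm_num : (0 : ℝ) < 2)]
  congr 3
  ring

/-- `φ` is the modulus of a geometric sum, also where its denominator vanishes. -/
theorem norm_sum_expTwoPi (q : ℕ) (c x : ℝ) :
    ‖∑ j ∈ Finset.range q, expTwoPi (j * (x + c))‖ = phi q c x := by
  simp only [expTwoPi_nat_mul]
  unfold phi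
  split_ifs with h
  · have h1 : expTwoPi (x + c) = 1 := by
      rw [← sub_eq_zero, ← norm_eq_zero, norm_expTwoPi_sub_one, h]; simp
    simp [h1]
  · have h1 : expTwoPi (x + c) ≠ 1 := by
      rw [← sub_ne_zero, ← norm_ne_zero_iff, norm_expTwoPi_sub_one]
      positivity
    rw [geom_sum_eq h1, norm_div, ← expTwoPi_nat_mul, norm_expTwoPi_sub_one,
      norm_expTwoPi_sub_one, mul_div_mul_left _ _ two_ne_zero, abs_div]
    ring_nf

theorem phi_nonneg (q : ℕ) (c x : ℝ) : 0 ≤ phi q c x := by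
  rw [← norm_sum_expTwoPi]; positivity

theorem phi_le (q : ℕ) (c x : ℝ) : phi q c x ≤ q := by
  rw [← norm_sum_expTwoPi]
  refine (norm_sum_le _ _).trans ?_
  simp

theorem continuous_expTwoPi : Continuous expTwoPi := by
  unfold expTwoPi; fun_prop

theorem continuous_phi (q : ℕ) (c : ℝ) : Continuous (phi q c) := by
  have h : phi q c = fun x => ‖∑ j ∈ Finset.range q, expTwoPi (j * (x + c))‖ :=
    funext fun x => (norm_sum_expTwoPi q c x).symm
  rw [h]
  have := continuous_expTwoPi
  fun_prop

theorem phi_add_int (q : ℕ) (c x : ℝ) (k : ℤ) : phi q c (x + k) = phi q c x := by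
  simpa using (phi_periodic q c).int_mul k x

theorem phi_eq_phi_zero (q : ℕ) (c x : ℝ) : phi q c x = phi q 0 (x + c) := by
  simp [phi]

theorem digitSum_mul_add {q : ℕ} (hq : 2 ≤ q) (n : ℕ) {j : ℕ} (hj : j < q) :
    digitSum q (q * n + j) = j + digitSum q n := by
  unfold digitSum
  by_cases h : j = 0 ∧ n = 0
  · simp [h.1, h.2]
  · rw [add_comm, Nat.digits_add q hq j n hj (by omega)]
    simp

theorem thueMorse_eq (q : ℕ) (c : ℝ) (n : ℕ) :
    thueMorse q c n = expTwoPi (c * digitSum q n) := by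
  simp only [thueMorse, expTwoPi]
  push_cast
  ring_nf

theorem sigma_eq (q : ℕ) (c : ℝ) (N : ℕ) (x : ℝ) :
    sigma q c N x = ∑ n ∈ Finset.range N, expTwoPi (c * digitSum q n + n * x) := by
  unfold sigma
  refine Finset.sum_congr rfl fun n _ => ?_
  rw [expTwoPi_add, thueMorse_eq]
  congr 1
  simp only [expTwoPi]
  push_cast
  ring_nf

/-- The recursion coming from splitting off the last digit of each index. -/
theorem sigma_mul_add {q : ℕ} (hq : 2 ≤ q) (c x : ℝ) (N : ℕ) {r : ℕ} (hr : r ≤ q) :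
    sigma q c (q * N + r) x =
      (∑ j ∈ Finset.range q, expTwoPi (j * (x + c))) * sigma q c N (q * x) +
      expTwoPi (c * digitSum q N + N * (q * x)) * ∑ j ∈ Finset.range r, expTwoPi (j * (x + c)) := by
  have key : ∀ (M : ℕ) {s : ℕ}, s ≤ q →
      ∑ j ∈ Finset.range s, expTwoPi (c * digitSum q (q * M + j) + (q * M + j : ℕ) * x) =
        expTwoPi (c * digitSum q M + M * (q * x)) *
          ∑ j ∈ Finset.range s, expTwoPi (j * (x + c)) := by
    intro M s hs
    rw [Finset.mul_sum]
    refine Finset.sum_congr rfl fun j hj => ?_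
    rw [digitSum_mul_add hq M ((Finset.mem_range.1 hj).trans_le hs), ← expTwoPi_add]
    push_cast
    ring_nf
  have hmul : ∀ M : ℕ, sigma q c (q * M) x =
      (∑ j ∈ Finset.range q, expTwoPi (j * (x + c))) * sigma q c M (q * x) := by
    intro M
    induction M with
    | zero => simp [sigma]
    | succ M ih =>
      rw [mul_add_one, sigma_eq, Finset.sum_range_add, ← sigma_eq, ih, key M le_rfl, sigma_eq,
        sigma_eq, Finset.sum_range_succ]
      ring
  rw [sigma_eq, Finset.sum_range_add, ← sigma_eq, hmul, key N hr]

/-- The product `φ(x) φ(qx) ⋯ φ(q^(n-1) x)`. -/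
def orbitProd (q : ℕ) (c : ℝ) (n : ℕ) (x : ℝ) : ℝ :=
  ∏ k ∈ Finset.range n, phi q c (q ^ k * x)

@[simp]
theorem orbitProd_zero (q : ℕ) (c x : ℝ) : orbitProd q c 0 x = 1 := by
  simp [orbitProd]

theorem orbitProd_add (q : ℕ) (c : ℝ) (m n : ℕ) (x : ℝ) :
    orbitProd q c (m + n) x = orbitProd q c m x * orbitProd q c n (q ^ m * x) := by
  unfold orbitProd
  rw [Finset.prod_range_add]
  congr 1
  refine Finset.prod_congr rfl fun k _ => ?_
  congr 1
  ring

@[simp]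
theorem orbitProd_one (q : ℕ) (c x : ℝ) : orbitProd q c 1 x = phi q c x := by
  simp [orbitProd]

theorem orbitProd_nonneg (q : ℕ) (c : ℝ) (n : ℕ) (x : ℝ) : 0 ≤ orbitProd q c n x :=
  Finset.prod_nonneg fun _ _ => phi_nonneg _ _ _

theorem orbitProd_le (q : ℕ) (c : ℝ) (n : ℕ) (x : ℝ) : orbitProd q c n x ≤ (q : ℝ) ^ n := by
  refine (Finset.prod_le_prod (fun _ _ => phi_nonneg _ _ _) (fun _ _ => phi_le _ _ _)).trans ?_
  simp

theorem continuous_orbitProd (q : ℕ) (c : ℝ) (n : ℕ) : Continuous (orbitProd q c n) := by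
  unfold orbitProd
  have := continuous_phi q c
  fun_prop

theorem orbitProd_add_int (q : ℕ) (c : ℝ) (n : ℕ) (x : ℝ) (k : ℤ) :
    orbitProd q c n (x + k) = orbitProd q c n x := by
  refine Finset.prod_congr rfl fun i _ => ?_
  rw [← phi_add_int q c (q ^ i * x) (q ^ i * k)]
  push_cast
  ring_nf

theorem norm_sigma_mul_add_le {q : ℕ} (hq : 2 ≤ q) (c x : ℝ) (N : ℕ) {r : ℕ} (hr : r ≤ q) :
    ‖sigma q c (q * N + r) x‖ ≤ phi q c x * ‖sigma q c N (q * x)‖ + r := by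
  rw [sigma_mul_add hq c x N hr]
  refine (norm_add_le _ _).trans ?_
  rw [norm_mul, norm_sum_expTwoPi, norm_mul, norm_expTwoPi, one_mul]
  gcongr
  refine (norm_sum_le _ _).trans ?_
  simp

/-- At powers of `q` the modulus of `σ_N` is a product along an orbit of `x ↦ q x`. -/
theorem norm_sigma_pow {q : ℕ} (hq : 2 ≤ q) (c : ℝ) (n : ℕ) (x : ℝ) :
    ‖sigma q c (q ^ n) x‖ = orbitProd q c n x := by
  induction n generalizing x with
  | zero => simp [sigma, thueMorse, digitSum]
  | succ n ih =>
    have h := sigma_mul_add hq c x (q ^ n) (Nat.zero_le q)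
    rw [Finset.range_zero, Finset.sum_empty, mul_zero, add_zero, add_zero] at h
    rw [pow_succ', h, norm_mul, norm_sum_expTwoPi, ih, add_comm, orbitProd_add]
    simp

/-- Expanding `N` in base `q`, the sum `σ_N` is dominated by the products along orbits. -/
theorem norm_sigma_le_sum_orbitProd {q : ℕ} (hq : 2 ≤ q) (c : ℝ) (J : ℕ) (x : ℝ) {N : ℕ}
    (hN : N < q ^ J) : ‖sigma q c N x‖ ≤ q * ∑ k ∈ Finset.range J, orbitProd q c k x := by
  induction J generalizing x N with
  | zero =>
    have : N = 0 := by simpa using hN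
    simp [this, sigma]
  | succ J ih =>
    have hlt : N / q < q ^ J := Nat.div_lt_of_lt_mul (by rwa [pow_succ'] at hN)
    have hmod : N % q ≤ q := (Nat.mod_lt N (by omega)).le
    have h := norm_sigma_mul_add_le hq c x (N / q) hmod
    rw [Nat.div_add_mod] at h
    refine h.trans ?_
    have h1 : phi q c x * ‖sigma q c (N / q) (q * x)‖ ≤
        phi q c x * (q * ∑ k ∈ Finset.range J, orbitProd q c k (q * x)) :=
      mul_le_mul_of_nonneg_left (ih _ hlt) (phi_nonneg _ _ _)
    have h2 : ((N % q : ℕ) : ℝ) ≤ q := by exact_mod_cast hmod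
    have h3 : ∀ k, orbitProd q c (k + 1) x = phi q c x * orbitProd q c k (q * x) := by
      intro k
      rw [add_comm, orbitProd_add]
      simp
    rw [Finset.sum_range_succ', orbitProd_zero]
    simp only [h3, ← Finset.mul_sum]
    linarith

/-! ### A Bernstein inequality on the unit circle -/

open Polynomial in
theorem norm_eval_reflect_le {p : ℂ[X]} {N : ℕ} (hdeg : p.natDegree ≤ N) {M : ℝ}
    (hM : ∀ z : ℂ, ‖z‖ = 1 → ‖p.eval z‖ ≤ M) {w : ℂ} (hw : ‖w‖ ≤ 1) :
    ‖(p.reflect N).eval w‖ ≤ M := by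
  refine Complex.norm_le_of_forall_mem_frontier_norm_le (U := Metric.ball 0 1)
    (f := fun w => (p.reflect N).eval w) Metric.isBounded_ball
    (p.reflect N).differentiable.diffContOnCl ?_ ?_
  · intro z hz
    rw [frontier_ball _ one_ne_zero, mem_sphere_zero_iff_norm] at hz
    have hz0 : z ≠ 0 := by rw [← norm_ne_zero_iff, hz]; exact one_ne_zero
    let _ : Invertible z⁻¹ := invertibleOfNonzero (inv_ne_zero hz0)
    have h := eval₂_reflect_mul_pow (RingHom.id ℂ) z⁻¹ N p hdeg
    rw [invOf_eq_inv, inv_inv] at h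
    have h' := congrArg norm h
    rw [norm_mul, norm_pow, norm_inv, hz, inv_one, one_pow, mul_one] at h'
    exact h'.le.trans (hM _ (by rw [norm_inv, hz, inv_one]))
  · rwa [closure_ball _ one_ne_zero, mem_closedBall_zero_iff]

open Polynomial in
/-- A polynomial bounded by `M` on the unit circle grows at most like `M |z|^N` outside. -/
theorem norm_eval_le_mul_pow {p : ℂ[X]} {N : ℕ} (hdeg : p.natDegree ≤ N) {M : ℝ}
    (hM : ∀ z : ℂ, ‖z‖ = 1 → ‖p.eval z‖ ≤ M) {z : ℂ} (hz : 1 ≤ ‖z‖) :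
    ‖p.eval z‖ ≤ M * ‖z‖ ^ N := by
  have hz0 : z ≠ 0 := by rw [← norm_pos_iff]; linarith
  let _ : Invertible z := invertibleOfNonzero hz0
  have h := eval₂_reflect_mul_pow (RingHom.id ℂ) z N p hdeg
  rw [invOf_eq_inv] at h
  change (p.reflect N).eval z⁻¹ * z ^ N = p.eval z at h
  rw [← h, norm_mul, norm_pow]
  gcongr
  exact norm_eval_reflect_le hdeg hM (by rw [norm_inv]; exact inv_le_one_of_one_le₀ hz)

/-- `1 / (1 - w)` has real part larger than `1 / 2` for `|w| < 1`. -/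
theorem half_lt_re_div_sub {z a : ℂ} (hz : ‖z‖ = 1) (ha : ‖a‖ < 1) :
    1 / 2 < (z * (1 / (z - a))).re := by
  have hza : z - a ≠ 0 := by
    intro h
    rw [sub_eq_zero] at h
    rw [← h, hz] at ha
    exact lt_irrefl _ ha
  have h1 : 0 < Complex.normSq (z - a) := Complex.normSq_pos.2 hza
  have h2 : Complex.normSq z = 1 := by rw [Complex.normSq_eq_norm_sq, hz]; norm_num
  have h3 : Complex.normSq a < 1 := by
    rw [Complex.normSq_eq_norm_sq]; nlinarith [norm_nonneg a]
  rw [mul_one_div, Complex.div_re, ← add_div, lt_div_iff₀ h1]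
  rw [Complex.normSq_apply] at h2 h3 ⊢
  simp only [Complex.sub_re, Complex.sub_im]
  nlinarith

open Polynomial in
/-- The Bernstein inequality for the trigonometric polynomial `exp (-i N θ / 2) p (exp (i θ))`,
whose frequencies lie in `[-N/2, N/2]`. If it failed at `z`, then for a suitable `λ` with
`|λ| > M` the polynomial `p - λ X^N`, all of whose `N` roots lie in the open unit disc, would
have logarithmic derivative `N / (2 z)` at `z`. -/
theorem norm_mul_eval_derivative_sub_le {p : ℂ[X]} {N : ℕ} (hdeg : p.natDegree ≤ N) {M : ℝ}
    (hM : ∀ z : ℂ, ‖z‖ = 1 → ‖p.eval z‖ ≤ M) {z : ℂ} (hz : ‖z‖ = 1) :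
    ‖z * p.derivative.eval z - (N / 2 : ℂ) * p.eval z‖ ≤ (N / 2 : ℝ) * M := by
  rcases Nat.eq_zero_or_pos N with rfl | hN
  · have : p.derivative = 0 := by
      rw [eq_C_of_natDegree_le_zero hdeg, derivative_C]
    simp [this]
  by_contra! hlt
  have hM0 : 0 ≤ M := (norm_nonneg _).trans (hM z hz)
  have hNpos : (0 : ℝ) < N := by exact_mod_cast hN
  have hNC : (N : ℂ) ≠ 0 := by exact_mod_cast hN.ne'
  have hz0 : z ≠ 0 := by rw [← norm_ne_zero_iff, hz]; exact one_ne_zero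
  set R : ℂ := z * p.derivative.eval z - (N / 2 : ℂ) * p.eval z with hR
  set l : ℂ := R / ((N / 2 : ℂ) * z ^ N) with hl
  have hlM : M < ‖l‖ := by
    rw [hl, norm_div, norm_mul, norm_pow, hz, one_pow, mul_one, norm_div, Complex.norm_natCast,
      Complex.norm_ofNat, lt_div_iff₀ (by positivity)]
    linarith
  set F : ℂ[X] := p - C l * X ^ N with hF
  have hroot : ∀ w : ℂ, F.eval w = 0 → ‖w‖ < 1 := by
    intro w hw
    by_contra! hw1
    have h1 := norm_eval_le_mul_pow hdeg hM hw1
    have h2 : p.eval w = l * w ^ N := by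
      rw [hF] at hw
      simpa [sub_eq_zero] using hw
    rw [h2, norm_mul, norm_pow] at h1
    exact absurd (le_of_mul_le_mul_right h1 (by positivity)) (not_le.2 hlM)
  have hcoeff : ‖p.coeff N‖ ≤ M := by
    have h := norm_eval_reflect_le hdeg hM (w := 0) (by simp)
    rwa [← coeff_zero_eq_eval_zero, coeff_reflect, revAt_le (Nat.zero_le N), Nat.sub_zero] at h
  have hFdeg : F.natDegree = N := by
    refine natDegree_eq_of_le_of_coeff_ne_zero ?_ ?_
    · exact (natDegree_sub_le _ _).trans (max_le hdeg (natDegree_C_mul_X_pow_le _ _))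
    · rw [hF, coeff_sub, coeff_C_mul_X_pow, if_pos rfl, sub_ne_zero]
      intro h
      rw [h] at hcoeff
      linarith
  have hFz : F.eval z ≠ 0 := fun h => by
    have := hroot z h
    rw [hz] at this
    exact lt_irrefl _ this
  have hder : z * F.derivative.eval z = (N / 2 : ℂ) * F.eval z := by
    have h1 : l * ((N / 2 : ℂ) * z ^ N) = R := by
      rw [hl]
      field_simp
    have h2 : F.derivative.eval z = p.derivative.eval z - l * (N * z ^ (N - 1)) := by
      simp [hF, derivative_X_pow]
    have h3 : z * z ^ (N - 1) = z ^ N := by rw [← pow_succ', Nat.sub_add_cancel hN]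
    have h4 : F.eval z = p.eval z - l * z ^ N := by simp [hF]
    rw [h2, h4]
    linear_combination -h1 - l * N * h3 + hR
  have hsplit : F.Splits := IsAlgClosed.splits F
  have hsum := hsplit.eval_derivative_eq_eval_mul_sum hFz
  have hsum' : (F.roots.map fun a => z * (1 / (z - a))).sum = (N / 2 : ℂ) := by
    rw [Multiset.sum_map_mul_left]
    refine mul_left_cancel₀ hFz ?_
    rw [mul_left_comm, ← hsum, hder]
    ring
  have hcard : Multiset.card F.roots = N := by
    rw [← hFdeg]; exact hsplit.natDegree_eq_card_roots.symm
  have hre := congrArg Complex.re hsum'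
  rw [← Complex.coe_reAddGroupHom, map_multiset_sum, Multiset.map_map] at hre
  have hlt' : (F.roots.map fun _ => (1 / 2 : ℝ)).sum <
      (F.roots.map (Complex.reAddGroupHom ∘ fun a => z * (1 / (z - a)))).sum := by
    refine Multiset.sum_lt_sum_of_nonempty ?_ ?_
    · intro h
      have h0 : Multiset.card F.roots = 0 := Multiset.card_eq_zero.2 h
      omega
    · intro a ha
      exact half_lt_re_div_sub hz (hroot a (isRoot_of_mem_roots ha))
  rw [hre, Multiset.map_const', Multiset.sum_replicate, hcard] at hlt'
  have : Complex.reAddGroupHom (N / 2 : ℂ) = (N / 2 : ℝ) := by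
    rw [Complex.coe_reAddGroupHom, ← Complex.ofReal_natCast, ← Complex.ofReal_ofNat,
      ← Complex.ofReal_div, Complex.ofReal_re]
  rw [this, nsmul_eq_mul] at hlt'
  linarith

theorem hasDerivAt_expTwoPi (t : ℝ) :
    HasDerivAt expTwoPi (2 * Real.pi * Complex.I * expTwoPi t) t := by
  have h := ((Complex.ofRealCLM.hasDerivAt (x := t)).const_mul (2 * Real.pi * Complex.I)).cexp
  simp only [Complex.ofRealCLM_apply, Complex.ofReal_one, mul_one] at h
  refine h.congr_deriv ?_
  rw [expTwoPi, mul_comm]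

theorem exists_expTwoPi_eq {z : ℂ} (hz : ‖z‖ = 1) : ∃ x : ℝ, expTwoPi x = z := by
  refine ⟨z.arg / (2 * Real.pi), ?_⟩
  have h := Complex.norm_mul_exp_arg_mul_I z
  rw [hz, Complex.ofReal_one, one_mul] at h
  rw [expTwoPi, ← h]
  congr 1
  have : (Real.pi : ℂ) ≠ 0 := by exact_mod_cast Real.pi_ne_zero
  push_cast
  rw [h]
  field_simp

open Polynomial in
/-- The polynomial whose values on the unit circle are those of `σ_N`. -/
def sigmaPoly (q : ℕ) (c : ℝ) (K : ℕ) : ℂ[X] :=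
  ∑ n ∈ Finset.range K, C (thueMorse q c n) * X ^ n

theorem eval_sigmaPoly (q : ℕ) (c : ℝ) (K : ℕ) (x : ℝ) :
    (sigmaPoly q c K).eval (expTwoPi x) = sigma q c K x := by
  simp only [sigmaPoly, Polynomial.eval_finsetSum, Polynomial.eval_mul, Polynomial.eval_C,
    Polynomial.eval_pow, Polynomial.eval_X, ← expTwoPi_nat_mul, sigma]
  refine Finset.sum_congr rfl fun n _ => ?_
  simp only [expTwoPi]
  push_cast
  ring_nf

theorem natDegree_sigmaPoly_le (q : ℕ) (c : ℝ) (N : ℕ) :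
    (sigmaPoly q c (N + 1)).natDegree ≤ N :=
  Polynomial.natDegree_sum_le_of_forall_le _ _ fun n hn =>
    (Polynomial.natDegree_C_mul_X_pow_le _ _).trans (by
      have := Finset.mem_range.1 hn
      omega)

/-- If `M` bounds `|σ_{N+1}|`, then `|σ_{N+1}|` is Lipschitz with constant `π N M`: it is the modulus
of a trigonometric polynomial with frequencies in `[-N/2, N/2]`. -/
theorem norm_sigma_sub_le {q : ℕ} {c : ℝ} {N : ℕ} {M : ℝ}
    (hM : ∀ x, ‖sigma q c (N + 1) x‖ ≤ M) (w y : ℝ) :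
    ‖sigma q c (N + 1) y‖ - Real.pi * N * M * |w - y| ≤ ‖sigma q c (N + 1) w‖ := by
  set p := sigmaPoly q c (N + 1) with hp
  have hMp : ∀ z : ℂ, ‖z‖ = 1 → ‖p.eval z‖ ≤ M := by
    intro z hz
    obtain ⟨x, rfl⟩ := exists_expTwoPi_eq hz
    rw [hp, eval_sigmaPoly]
    exact hM x
  set T : ℝ → ℂ := fun x => expTwoPi (-(N / 2) * x) * p.eval (expTwoPi x) with hT
  have hnorm : ∀ x, ‖T x‖ = ‖sigma q c (N + 1) x‖ := by
    intro x
    rw [hT, hp]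
    simp only [norm_mul, norm_expTwoPi, one_mul, eval_sigmaPoly]
  have hder : ∀ x, HasDerivAt T (2 * Real.pi * Complex.I * expTwoPi (-(N / 2) * x) *
      (expTwoPi x * p.derivative.eval (expTwoPi x) - (N / 2 : ℂ) * p.eval (expTwoPi x))) x := by
    intro x
    have h1 : HasDerivAt (fun x : ℝ => expTwoPi (-(N / 2) * x))
        ((-(N / 2) : ℝ) • (2 * Real.pi * Complex.I * expTwoPi (-(N / 2) * x))) x := by
      have := (hasDerivAt_expTwoPi (-(N / 2) * x)).scomp x
        ((hasDerivAt_id x).const_mul (-(N / 2) : ℝ))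
      simpa [Function.comp_def] using this
    have h2 : HasDerivAt (fun x : ℝ => p.eval (expTwoPi x))
        (p.derivative.eval (expTwoPi x) * (2 * Real.pi * Complex.I * expTwoPi x)) x :=
      (p.hasDerivAt (expTwoPi x)).comp x (hasDerivAt_expTwoPi x)
    refine (h1.mul h2).congr_deriv ?_
    rw [Complex.real_smul]
    push_cast
    ring
  have hbound : ∀ x ∈ (Set.univ : Set ℝ), ‖2 * Real.pi * Complex.I * expTwoPi (-(N / 2) * x) *
      (expTwoPi x * p.derivative.eval (expTwoPi x) - (N / 2 : ℂ) * p.eval (expTwoPi x))‖ ≤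
      Real.pi * N * M := by
    intro x _
    have h := norm_mul_eval_derivative_sub_le (natDegree_sigmaPoly_le q c N) hMp
      (norm_expTwoPi x)
    rw [norm_mul, norm_mul, norm_mul, norm_mul, Complex.norm_I, norm_expTwoPi, Complex.norm_ofNat,
      Complex.norm_real, Real.norm_of_nonneg Real.pi_pos.le]
    have := mul_le_mul_of_nonneg_left h (by positivity : 0 ≤ 2 * Real.pi * 1 * 1)
    linarith
  have h := convex_univ.norm_image_sub_le_of_norm_hasDerivWithin_le
    (fun x _ => (hder x).hasDerivWithinAt) hbound (Set.mem_univ y) (Set.mem_univ w)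
  have h2 := norm_sub_norm_le (T y) (T w)
  rw [norm_sub_rev] at h2
  rw [hnorm, hnorm] at h2
  rw [Real.norm_eq_abs] at h
  linarith

/-! ### Integrals of `f_c` against invariant measures -/

/-- The function `φ` on the circle. -/
def phiCircle (q : ℕ) (c : ℝ) : UnitAddCircle → ℝ := (phi_periodic q c).lift

theorem phiCircle_coe (q : ℕ) (c x : ℝ) : phiCircle q c (x : UnitAddCircle) = phi q c x := rfl

theorem continuous_phiCircle (q : ℕ) (c : ℝ) : Continuous (phiCircle q c) :=
  continuous_coinduced_dom.2 (continuous_phi q c)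

theorem phiCircle_nonneg (q : ℕ) (c : ℝ) (x : UnitAddCircle) : 0 ≤ phiCircle q c x := by
  induction x using QuotientAddGroup.induction_on with
  | H x => exact phi_nonneg q c x

theorem phiCircle_le (q : ℕ) (c : ℝ) (x : UnitAddCircle) : phiCircle q c x ≤ q := by
  induction x using QuotientAddGroup.induction_on with
  | H x => exact phi_le q c x

theorem logPhi_of_pos {q : ℕ} {c : ℝ} {x : UnitAddCircle} (hx : 0 < phiCircle q c x) :
    logPhi q c x = ((Real.log (phiCircle q c x) : ℝ) : EReal) := by
  unfold logPhi
  change ENNReal.log (ENNReal.ofReal (phiCircle q c x)) = _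
  exact ENNReal.log_ofReal_of_pos hx

theorem logPhi_of_eq_zero {q : ℕ} {c : ℝ} {x : UnitAddCircle} (hx : phiCircle q c x = 0) :
    logPhi q c x = ⊥ := by
  unfold logPhi
  change ENNReal.log (ENNReal.ofReal (phiCircle q c x)) = _
  rw [hx, ENNReal.ofReal_zero, ENNReal.log_zero]

theorem measurable_log_phiCircle (q : ℕ) (c : ℝ) :
    Measurable fun x => Real.log (phiCircle q c x) :=
  (continuous_phiCircle q c).measurable.log

/-- Where `φ` does not vanish almost everywhere and `log φ` is integrable, the extended
integral of `f_c` is an ordinary one. -/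
theorem extIntegral_logPhi {q : ℕ} {c : ℝ} {μ : Measure UnitAddCircle}
    (hpos : ∀ᵐ x ∂μ, 0 < phiCircle q c x)
    (hint : Integrable (fun x => Real.log (phiCircle q c x)) μ) :
    extIntegral μ (logPhi q c) = ((∫ x, Real.log (phiCircle q c x) ∂μ : ℝ) : EReal) := by
  have h1 : ∫⁻ x, (logPhi q c x).toENNReal ∂μ =
      ∫⁻ x, ENNReal.ofReal (Real.log (phiCircle q c x)) ∂μ := by
    refine lintegral_congr_ae ?_
    filter_upwards [hpos] with x hx
    rw [logPhi_of_pos hx, EReal.toENNReal_of_ne_top (EReal.coe_ne_top _), EReal.toReal_coe]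
  have h2 : ∫⁻ x, (-logPhi q c x).toENNReal ∂μ =
      ∫⁻ x, ENNReal.ofReal (-Real.log (phiCircle q c x)) ∂μ := by
    refine lintegral_congr_ae ?_
    filter_upwards [hpos] with x hx
    rw [logPhi_of_pos hx, ← EReal.coe_neg, EReal.toENNReal_of_ne_top (EReal.coe_ne_top _),
      EReal.toReal_coe]
  have hfin1 : ∫⁻ x, ENNReal.ofReal (Real.log (phiCircle q c x)) ∂μ ≠ ⊤ :=
    hint.lintegral_lt_top.ne
  have hfin2 : ∫⁻ x, ENNReal.ofReal (-Real.log (phiCircle q c x)) ∂μ ≠ ⊤ :=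
    hint.neg.lintegral_lt_top.ne
  rw [extIntegral, h1, h2, integral_eq_lintegral_pos_part_sub_lintegral_neg_part hint,
    EReal.coe_sub, EReal.coe_ennreal_toReal hfin1, EReal.coe_ennreal_toReal hfin2]

theorem measurable_logPhi (q : ℕ) (c : ℝ) : Measurable (logPhi q c) := by
  have : logPhi q c = fun x => ENNReal.log (ENNReal.ofReal (phiCircle q c x)) := rfl
  rw [this]
  exact ENNReal.measurable_log.comp (continuous_phiCircle q c).measurable.ennreal_ofReal

theorem prod_phiCircle_coe (q : ℕ) (c : ℝ) (n : ℕ) (x : ℝ) :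
    ∏ k ∈ Finset.range n, phiCircle q c (q ^ k • (x : UnitAddCircle)) = orbitProd q c n x := by
  refine Finset.prod_congr rfl fun k _ => ?_
  rw [← AddCircle.coe_nsmul, phiCircle_coe, nsmul_eq_mul]
  push_cast
  rfl

theorem iterate_nsmul (q k : ℕ) :
    (fun x : UnitAddCircle => q • x)^[k] = fun x => q ^ k • x := by
  induction k with
  | zero => ext x; simp
  | succ k ih =>
    rw [Function.iterate_succ', ih]
    ext x
    simp only [Function.comp_apply, smul_smul, pow_succ']

/-- Integrating the Birkhoff sum of `log φ` against an invariant measure. The integral is `-∞`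
unless the negative part of `log φ` is integrable. -/
theorem extIntegral_logPhi_le {q : ℕ} {c : ℝ} {μ : ProbabilityMeasure UnitAddCircle}
    (hμ : μ ∈ invariantMeasures q) {n : ℕ} (hn : 1 ≤ n) {K : ℝ}
    (h : ∀ x, orbitProd q c n x ≤ K) :
    extIntegral (μ : Measure UnitAddCircle) (logPhi q c) ≤ ((Real.log K / n : ℝ) : EReal) := by
  by_cases htop : ∫⁻ x, (-logPhi q c x).toENNReal ∂(μ : Measure UnitAddCircle) = ⊤
  · rw [extIntegral, htop, EReal.coe_ennreal_top, EReal.sub_top]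
    exact bot_le
  have hmeas : Measurable fun x => (-logPhi q c x).toENNReal :=
    (measurable_logPhi q c).neg.ereal_toENNReal
  have hpos : ∀ᵐ x ∂(μ : Measure UnitAddCircle), 0 < phiCircle q c x := by
    filter_upwards [ae_lt_top hmeas htop] with x hx
    refine (phiCircle_nonneg q c x).lt_of_ne fun h0 => ?_
    rw [logPhi_of_eq_zero h0.symm] at hx
    simp at hx
  set g : UnitAddCircle → ℝ := fun x => Real.log (phiCircle q c x) with hg
  have hgmeas : Measurable g := measurable_log_phiCircle q c
  have hneg : ∫⁻ x, ENNReal.ofReal (-g x) ∂(μ : Measure UnitAddCircle) ≠ ⊤ := by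
    rw [← lintegral_congr_ae (f := fun x => (-logPhi q c x).toENNReal)]
    · exact htop
    · filter_upwards [hpos] with x hx
      rw [logPhi_of_pos hx, ← EReal.coe_neg, EReal.toENNReal_of_ne_top (EReal.coe_ne_top _),
        EReal.toReal_coe]
  have hint : Integrable g (μ : Measure UnitAddCircle) := by
    have h1 : Integrable (fun x => max (-g x) 0) (μ : Measure UnitAddCircle) := by
      refine ⟨(hgmeas.neg.max measurable_const).aestronglyMeasurable, ?_⟩
      rw [hasFiniteIntegral_iff_ofReal (f := fun x => max (-g x) 0)
        (ae_of_all _ fun x => le_max_right _ _)]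
      refine lt_of_le_of_lt (le_of_eq ?_) hneg.lt_top
      refine lintegral_congr fun x => ?_
      rw [ENNReal.ofReal_max, ENNReal.ofReal_zero, max_eq_left (by simp)]
    refine (h1.add (integrable_const (Real.log q))).mono' hgmeas.aestronglyMeasurable ?_
    filter_upwards [hpos] with x hx
    have hle : g x ≤ Real.log q := Real.log_le_log hx (phiCircle_le q c x)
    have hq0 : 0 ≤ Real.log q := Real.log_natCast_nonneg q
    rw [Real.norm_eq_abs]
    refine abs_le.2 ⟨?_, ?_⟩
    · have := le_max_left (-g x) 0
      simp only [Pi.add_apply]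
      linarith
    · have := le_max_right (-g x) 0
      simp only [Pi.add_apply]
      linarith
  rw [extIntegral_logPhi hpos hint]
  rw [EReal.coe_le_coe_iff]
  have hpres : ∀ k, MeasurePreserving (fun x : UnitAddCircle => q ^ k • x)
      (μ : Measure UnitAddCircle) (μ : Measure UnitAddCircle) := by
    intro k
    have := MeasurePreserving.iterate (hμ : MeasurePreserving _ _ _) k
    rwa [iterate_nsmul] at this
  have hintk : ∀ k, Integrable (fun x => g (q ^ k • x)) (μ : Measure UnitAddCircle) :=
    fun k => (hpres k).integrable_comp_of_integrable hint
  have hsum : ∫ x, ∑ k ∈ Finset.range n, g (q ^ k • x) ∂(μ : Measure UnitAddCircle) =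
      n * ∫ x, g x ∂(μ : Measure UnitAddCircle) := by
    rw [integral_finsetSum _ fun k _ => hintk k]
    have : ∀ k ∈ Finset.range n, ∫ x, g (q ^ k • x) ∂(μ : Measure UnitAddCircle) =
        ∫ x, g x ∂(μ : Measure UnitAddCircle) := by
      intro k _
      have hmap := (hpres k).map_eq
      conv_rhs => rw [← hmap]
      rw [integral_map (hpres k).measurable.aemeasurable hgmeas.aestronglyMeasurable]
    rw [Finset.sum_congr rfl this]
    simp
  have hposk : ∀ᵐ x ∂(μ : Measure UnitAddCircle), ∀ k, 0 < phiCircle q c (q ^ k • x) :=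
    ae_all_iff.2 fun k => (hpres k).quasiMeasurePreserving.ae hpos
  have hle : ∫ x, ∑ k ∈ Finset.range n, g (q ^ k • x) ∂(μ : Measure UnitAddCircle) ≤
      ∫ _, Real.log K ∂(μ : Measure UnitAddCircle) := by
    refine integral_mono_ae (integrable_finsetSum _ fun k _ => hintk k) (integrable_const _) ?_
    filter_upwards [hposk] with x hx
    simp only [hg]
    rw [← Real.log_prod fun k _ => (hx k).ne']
    refine Real.log_le_log (Finset.prod_pos fun k _ => hx k) ?_
    induction x using QuotientAddGroup.induction_on with
    | H x => exact (prod_phiCircle_coe q c n x).le.trans (h x)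
  rw [hsum] at hle
  have hn0 : (0 : ℝ) < n := by exact_mod_cast hn
  rw [le_div_iff₀ hn0]
  simp only [integral_const, probReal_univ, one_smul] at hle
  linarith

/-- An upper bound of the product along all orbit segments of length `n` bounds `β(c)`. -/
theorem beta_le {q : ℕ} {c : ℝ} {n : ℕ} (hn : 1 ≤ n) {K : ℝ}
    (h : ∀ x, orbitProd q c n x ≤ K) : beta q c ≤ ((Real.log K / n : ℝ) : EReal) :=
  iSup₂_le fun _ hμ => extIntegral_logPhi_le hμ hn h

/-- A periodic orbit carries an invariant measure, which bounds `β(c)` from below. -/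
theorem le_beta_of_periodic {q : ℕ} {c : ℝ} {n : ℕ} (hn : 1 ≤ n) {x : ℝ} {k : ℤ}
    (hx : q ^ n * x = x + k) (hpos : 0 < orbitProd q c n x) :
    ((Real.log (orbitProd q c n x) / n : ℝ) : EReal) ≤ beta q c := by
  have hn0 : (n : ℝ≥0∞) ≠ 0 := by exact_mod_cast (by omega : n ≠ 0)
  have hper : q ^ n • (x : UnitAddCircle) = (x : UnitAddCircle) := by
    rw [← AddCircle.coe_nsmul, nsmul_eq_mul]
    push_cast
    rw [hx, AddCircle.coe_add]
    have : ((k : ℝ) : UnitAddCircle) = 0 := by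
      rw [AddCircle.coe_eq_zero_iff]
      exact ⟨k, by simp⟩
    rw [this, add_zero]
  set ν : Measure UnitAddCircle :=
    (n : ℝ≥0∞)⁻¹ • ∑ i ∈ Finset.range n, Measure.dirac (q ^ i • (x : UnitAddCircle)) with hν
  have hprob : IsProbabilityMeasure ν := by
    constructor
    simp only [hν, Measure.smul_apply, Measure.finsetSum_apply, measure_univ, Finset.sum_const,
      Finset.card_range, nsmul_eq_mul, mul_one, smul_eq_mul]
    exact ENNReal.inv_mul_cancel hn0 (ENNReal.natCast_ne_top n)
  have hTmeas : Measurable fun y : UnitAddCircle => q • y :=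
    (continuous_nsmul q).measurable
  have hinv : MeasurePreserving (fun y : UnitAddCircle => q • y) ν ν := by
    refine ⟨hTmeas, ?_⟩
    rw [hν, Measure.map_smul, Measure.map_finset_sum hTmeas.aemeasurable]
    congr 1
    simp only [Measure.map_dirac' hTmeas, smul_smul, ← pow_succ']
    obtain ⟨m, rfl⟩ : ∃ m, n = m + 1 := ⟨n - 1, by omega⟩
    rw [Finset.sum_range_succ, hper,
      Finset.sum_range_succ' (fun i => Measure.dirac (q ^ i • (x : UnitAddCircle))), pow_zero,
      one_smul]
  have hposi : ∀ i ∈ Finset.range n, 0 < phiCircle q c (q ^ i • (x : UnitAddCircle)) := by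
    intro i hi
    refine (phiCircle_nonneg q c _).lt_of_ne fun h0 => hpos.ne' ?_
    rw [← prod_phiCircle_coe]
    exact Finset.prod_eq_zero hi h0.symm
  have hae : ∀ᵐ y ∂ν, 0 < phiCircle q c y := by
    refine Measure.ae_smul_measure (ae_finsetSum_measure_iff.2 fun i hi => ?_) _
    rw [ae_dirac_eq]
    exact hposi i hi
  have hintd : ∀ i ∈ Finset.range n, Integrable (fun y => Real.log (phiCircle q c y))
      (Measure.dirac (q ^ i • (x : UnitAddCircle))) :=
    fun i _ => integrable_dirac enorm_lt_top
  have hint : Integrable (fun y => Real.log (phiCircle q c y)) ν :=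
    (integrable_finsetSum_measure.2 hintd).smul_measure (ENNReal.inv_ne_top.2 hn0)
  have hval : ∫ y, Real.log (phiCircle q c y) ∂ν = Real.log (orbitProd q c n x) / n := by
    rw [hν, integral_smul_measure, integral_finsetSum_measure hintd]
    simp only [integral_dirac]
    rw [← Real.log_prod fun i hi => (hposi i hi).ne', prod_phiCircle_coe, ENNReal.toReal_inv,
      ENNReal.toReal_natCast, smul_eq_mul, inv_mul_eq_div]
  have h := extIntegral_logPhi hae hint
  rw [hval] at h
  rw [← h]
  exact le_iSup₂_of_le (⟨ν, hprob⟩ : ProbabilityMeasure UnitAddCircle) hinv le_rfl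

/-! ### Elementary bounds for `φ` -/

theorem abs_sin_pi_mul_add_int (t : ℝ) (m : ℤ) :
    |Real.sin (Real.pi * (t + m))| = |Real.sin (Real.pi * t)| := by
  rw [mul_add, mul_comm Real.pi (m : ℝ), Real.sin_add_int_mul_pi, abs_mul, abs_zpow, abs_neg,
    abs_one, one_zpow, one_mul]

theorem abs_sin_pi_mul_le (t : ℝ) : |Real.sin (Real.pi * t)| ≤ Real.pi * |t| := by
  refine Real.abs_sin_le_abs.trans ?_
  rw [abs_mul, abs_of_pos Real.pi_pos]

theorem two_mul_abs_le_abs_sin {t : ℝ} (ht : |t| ≤ 1 / 2) :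
    2 * |t| ≤ |Real.sin (Real.pi * t)| := by
  have h := Real.mul_abs_le_abs_sin (x := Real.pi * t) (by
    rw [abs_mul, abs_of_pos Real.pi_pos]
    nlinarith [Real.pi_pos])
  rw [abs_mul, abs_of_pos Real.pi_pos] at h
  have h2 : 2 / Real.pi * (Real.pi * |t|) = 2 * |t| := by
    field_simp
  linarith

theorem abs_sin_sub_le (a b : ℝ) : |Real.sin a| - |Real.sin b| ≤ |Real.sin (a - b)| := by
  have h : Real.sin a = Real.sin (a - b) * Real.cos b + Real.cos (a - b) * Real.sin b := by
    rw [← Real.sin_add, sub_add_cancel]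
  have h1 : |Real.sin a| ≤ |Real.sin (a - b)| + |Real.sin b| := by
    rw [h]
    refine (abs_add_le _ _).trans ?_
    rw [abs_mul, abs_mul]
    gcongr
    · exact mul_le_of_le_one_right (abs_nonneg _) (Real.abs_cos_le_one b)
    · exact mul_le_of_le_one_left (abs_nonneg _) (Real.abs_cos_le_one _)
  linarith

theorem abs_sin_le_phi {q : ℕ} (hq : 2 ≤ q) (c x : ℝ) :
    |Real.sin (Real.pi * (q * (x + c)))| ≤ phi q c x := by
  unfold phi
  split_ifs with h
  · have : (2 : ℝ) ≤ q := by exact_mod_cast hq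
    linarith [Real.abs_sin_le_one (Real.pi * (q * (x + c)))]
  · rw [abs_div, ← mul_assoc]
    exact le_div_self (abs_nonneg _) (abs_pos.2 h) (Real.abs_sin_le_one _)

theorem four_div_pi_le_phi {q : ℕ} (hq : 2 ≤ q) {t : ℝ} (ht : |q * t| ≤ 1 / 2) :
    4 / Real.pi ≤ phi q 0 t := by
  have hq2 : (2 : ℝ) ≤ q := by exact_mod_cast hq
  have hpi := Real.pi_gt_three
  unfold phi
  rw [add_zero]
  split_ifs with h
  · rw [div_le_iff₀ Real.pi_pos]
    nlinarith
  · have h1 := two_mul_abs_le_abs_sin ht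
    have h2 := abs_sin_pi_mul_le t
    rw [abs_mul, abs_of_nonneg (by positivity : (0 : ℝ) ≤ q)] at h1
    rw [abs_div, le_div_iff₀ (abs_pos.2 h), mul_assoc]
    refine le_trans ?_ h1
    rw [div_mul_eq_mul_div, div_le_iff₀ Real.pi_pos]
    have h3 : 2 * (Real.pi * |t|) ≤ q * (Real.pi * |t|) := by gcongr
    linarith

theorem abs_phi_sub_phi_le (q : ℕ) (c s t : ℝ) :
    |phi q c s - phi q c t| ≤ 2 * Real.pi * q ^ 2 * |s - t| := by
  rw [← norm_sum_expTwoPi, ← norm_sum_expTwoPi]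
  refine (abs_norm_sub_norm_le _ _).trans ?_
  rw [← Finset.sum_sub_distrib]
  refine (norm_sum_le _ _).trans ?_
  have h : ∀ j ∈ Finset.range q, ‖expTwoPi (j * (s + c)) - expTwoPi (j * (t + c))‖ ≤
      2 * Real.pi * q * |s - t| := by
    intro j hj
    have hjq : (j : ℝ) ≤ q := by exact_mod_cast (Finset.mem_range.1 hj).le
    have h1 : (j : ℝ) * (s + c) = j * (s - t) + j * (t + c) := by ring
    rw [h1, expTwoPi_add, ← sub_one_mul, norm_mul, norm_expTwoPi, mul_one, norm_expTwoPi_sub_one]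
    have h2 := abs_sin_pi_mul_le (j * (s - t))
    rw [abs_mul, Nat.abs_cast] at h2
    have h3 : Real.pi * ((j : ℝ) * |s - t|) ≤ Real.pi * (q * |s - t|) := by gcongr
    linarith
  refine (Finset.sum_le_sum h).trans ?_
  rw [Finset.sum_const, Finset.card_range, nsmul_eq_mul]
  apply le_of_eq
  ring

/-- Every point has a preimage under multiplication by `q` in the main lobe of `φ`. -/
theorem exists_pow_le_orbitProd {q : ℕ} (hq : 2 ≤ q) (c : ℝ) (n : ℕ) :
    ∃ x, (4 / Real.pi) ^ n ≤ orbitProd q c n x := by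
  have hq0 : (q : ℝ) ≠ 0 := by positivity
  induction n with
  | zero => exact ⟨0, by simp⟩
  | succ n ih =>
    obtain ⟨x, hx⟩ := ih
    set k : ℤ := round (x + q * c) with hk
    refine ⟨(x - k) / q, ?_⟩
    have h1 : (q : ℝ) * ((x - k) / q) = x + ((-k : ℤ) : ℝ) := by
      rw [mul_div_cancel₀ _ hq0]; push_cast; ring
    rw [add_comm, orbitProd_add, orbitProd_one, pow_one, h1, orbitProd_add_int, pow_add, pow_one]
    refine mul_le_mul ?_ hx (by positivity) (phi_nonneg _ _ _)
    rw [phi_eq_phi_zero]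
    refine four_div_pi_le_phi hq ?_
    have h2 : (q : ℝ) * ((x - k) / q + c) = (x + q * c) - k := by
      field_simp
      ring
    rw [h2]
    exact abs_sub_round _

/-! ### Closing up maximal orbits, for `(q - 1) c` away from the integers -/

/-- If `v` keeps away from the maximum of `φ_0`, then some shift of `v` by a multiple of `1 / q`
that is not an integer leads to a point where `φ_0` is not small. -/
theorem exists_shift_phi {q : ℕ} (hq : 2 ≤ q) {θ v : ℝ} (hv : θ ≤ |Real.sin (Real.pi * v)|) :
    ∃ i : ℤ, 2 / (q : ℝ) ≤ |Real.sin (Real.pi * (i / q))| ∧ θ ≤ phi q 0 (v + i / q) := by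
  have hq2 : (2 : ℝ) ≤ q := by exact_mod_cast hq
  have hq0 : (q : ℝ) ≠ 0 := by positivity
  have hqpos : (0 : ℝ) < q := by positivity
  have hsin : ∀ i : ℤ, ¬ (q : ℤ) ∣ i → 2 / (q : ℝ) ≤ |Real.sin (Real.pi * (i / q))| := by
    intro i hi
    set m : ℤ := round ((i : ℝ) / q) with hm
    have h1 := abs_sin_pi_mul_add_int ((i : ℝ) / q - m) m
    rw [sub_add_cancel] at h1
    rw [h1]
    refine le_trans ?_ (two_mul_abs_le_abs_sin (abs_sub_round _))
    have h2 : (i : ℝ) / q - m = ((i - q * m : ℤ) : ℝ) / q := by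
      push_cast
      field_simp
    have h3 : (1 : ℝ) ≤ |((i - q * m : ℤ) : ℝ)| := by
      rw [← Int.cast_abs]
      exact_mod_cast Int.one_le_abs fun h => hi ⟨m, by linarith⟩
    rw [h2, abs_div, abs_of_pos hqpos, ← mul_div_assoc]
    gcongr
    linarith
  set r : ℤ := round (q * v) with hr
  have hrv : |q * v - r| ≤ 1 / 2 := abs_sub_round _
  by_cases hdvd : (q : ℤ) ∣ r
  · -- `v` lies in the main lobe, and the shift moves it to a neighbouring lobe.
    obtain ⟨m, hm⟩ := hdvd
    refine ⟨1, hsin 1 fun h => ?_, ?_⟩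
    · have := Int.le_of_dvd one_pos h
      omega
    · refine le_trans ?_ (abs_sin_le_phi hq 0 _)
      have hrm : (r : ℝ) = q * m := by rw [hm]; push_cast; ring
      have h1 : (q : ℝ) * (v + (1 : ℤ) / q + 0) = q * (v - m) + ((q * m + 1 : ℤ) : ℝ) := by
        push_cast
        field_simp
        ring
      rw [h1, abs_sin_pi_mul_add_int]
      rw [hrm, ← mul_sub] at hrv
      refine le_trans ?_ (two_mul_abs_le_abs_sin hrv)
      have h2 := abs_sin_pi_mul_add_int (v - m) m
      rw [sub_add_cancel] at h2
      have h3 := abs_sin_pi_mul_le (v - m)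
      rw [abs_mul, abs_of_pos hqpos]
      have := Real.pi_lt_four
      have h4 : Real.pi * |v - m| ≤ 4 * |v - m| := by gcongr
      have h5 : 2 * (2 * |v - m|) ≤ 2 * (q * |v - m|) := by gcongr
      linarith
  · -- `v` lies outside the main lobe, and the shift moves it there.
    refine ⟨-r, hsin _ (by rwa [dvd_neg]), ?_⟩
    have h1 : 4 / Real.pi ≤ phi q 0 (v + ((-r : ℤ) : ℝ) / q) := by
      refine four_div_pi_le_phi hq ?_
      have : (q : ℝ) * (v + ((-r : ℤ) : ℝ) / q) = q * v - r := by
        push_cast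
        field_simp
        ring
      rwa [this]
    have h2 : 1 ≤ 4 / Real.pi := by
      rw [one_le_div Real.pi_pos]
      exact Real.pi_le_four
    linarith [Real.abs_sin_le_one (Real.pi * v)]

/-- If `(q - 1) c` is not close to an integer, then some coset of `q⁻¹ ℤ` inside `q⁻² ℤ` has the
property that translating by any of its elements does not decrease `φ(w) φ(q w)` by more than a
constant factor, for `w` close to `y`. The reason is that `y` and `q y` cannot both be close to
the maximum `-c` of `φ`. -/
theorem exists_shift_orbitProd {q : ℕ} (hq : 2 ≤ q) {δ : ℝ} (hδ : 0 < δ) :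
    ∃ ε > 0, ∃ η > 0, ∀ c y : ℝ, δ ≤ |Real.sin (Real.pi * ((q - 1) * c))| →
      ∃ i : ℤ, ∀ (k : ℤ) (w : ℝ), |w - y| ≤ η →
        ε * orbitProd q c 2 w ≤ orbitProd q c 2 (w + i / q ^ 2 + k / q) := by
  have hq2 : (2 : ℝ) ≤ q := by exact_mod_cast hq
  have hq0 : (q : ℝ) ≠ 0 := by positivity
  have hqpos : (0 : ℝ) < q := by positivity
  have hpi := Real.pi_pos
  have horb : ∀ c x, orbitProd q c 2 x = phi q c x * phi q c (q * x) := by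
    intro c x
    rw [show 2 = 1 + 1 from rfl, orbitProd_add, orbitProd_one, orbitProd_one, pow_one]
  set ε₁ : ℝ := min δ (2 / q) / 4 with hε₁
  have hε₁pos : 0 < ε₁ := by positivity
  have hε₁δ : 4 * ε₁ ≤ δ := by
    rw [hε₁, mul_div_cancel₀ _ (by norm_num)]; exact min_le_left _ _
  have hε₁q : 4 * ε₁ ≤ 2 / q := by
    rw [hε₁, mul_div_cancel₀ _ (by norm_num)]; exact min_le_right _ _
  set η : ℝ := min (ε₁ / (Real.pi * q)) (δ / 4 / (2 * Real.pi * q ^ 3)) with hη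
  have hηpos : 0 < η := by positivity
  have hη1 : Real.pi * q * η ≤ ε₁ := by
    have : η ≤ ε₁ / (Real.pi * q) := min_le_left _ _
    rw [le_div_iff₀ (by positivity)] at this
    linarith
  have hη2 : 2 * Real.pi * q ^ 3 * η ≤ δ / 4 := by
    have : η ≤ δ / 4 / (2 * Real.pi * q ^ 3) := min_le_right _ _
    rw [le_div_iff₀ (by positivity)] at this
    linarith
  refine ⟨min (ε₁ / q) (ε₁ * (δ / 4) / q ^ 2), by positivity, η, hηpos, ?_⟩
  intro c y hc
  have hclose : ∀ w, |w - y| ≤ η →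
      |Real.sin (Real.pi * (q * (w + c)) - Real.pi * (q * (y + c)))| ≤ ε₁ := by
    intro w hw
    refine Real.abs_sin_le_abs.trans ?_
    have : Real.pi * (q * (w + c)) - Real.pi * (q * (y + c)) = Real.pi * q * (w - y) := by ring
    rw [this, abs_mul, abs_of_pos (by positivity)]
    refine le_trans ?_ hη1
    gcongr
  by_cases hcase : 2 * ε₁ ≤ |Real.sin (Real.pi * (q * (y + c)))|
  · -- All points `w + k / q` keep away from the zeros of `φ`, and have the same image as `w`.
    refine ⟨0, fun k w hw => ?_⟩
    have h1 : ε₁ ≤ |Real.sin (Real.pi * (q * (w + c)))| := by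
      have h2 := abs_sin_sub_le (Real.pi * (q * (y + c))) (Real.pi * (q * (w + c)))
      have h3 := hclose w hw
      rw [← abs_neg, ← Real.sin_neg, neg_sub] at h3
      linarith
    have h2 : ε₁ ≤ phi q c (w + k / q) := by
      refine le_trans ?_ (abs_sin_le_phi hq c _)
      have : (q : ℝ) * (w + k / q + c) = q * (w + c) + k := by
        field_simp
        ring
      rwa [this, abs_sin_pi_mul_add_int]
    have h3 : phi q c (q * (w + k / q)) = phi q c (q * w) := by
      rw [← phi_add_int q c (q * w) k]
      congr 1
      field_simp
    have h4 : ε₁ / q * phi q c w ≤ phi q c (w + k / q) := by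
      refine le_trans ?_ h2
      rw [div_mul_eq_mul_div, div_le_iff₀ hqpos]
      exact mul_le_mul_of_nonneg_left (phi_le _ _ _) hε₁pos.le
    rw [Int.cast_zero, zero_div, add_zero, horb, horb, h3, ← mul_assoc]
    refine mul_le_mul_of_nonneg_right (le_trans ?_ h4) (phi_nonneg _ _ _)
    exact mul_le_mul_of_nonneg_right (min_le_left _ _) (phi_nonneg _ _ _)
  · -- Now `y` is close to a zero or the maximum of `φ`. Then `q y` keeps away from the maximum,
    -- and a shift by `i / q ^ 2` with `q ∤ i` makes both factors bounded below.
    push Not at hcase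
    have hv : δ / 2 ≤ |Real.sin (Real.pi * (q * y + c))| := by
      have h2 := abs_sin_sub_le (Real.pi * ((q - 1) * c)) (Real.pi * (q * (y + c)))
      have h3 : Real.pi * ((q - 1) * c) - Real.pi * (q * (y + c)) = -(Real.pi * (q * y + c)) := by
        ring
      rw [h3, Real.sin_neg, abs_neg] at h2
      linarith
    obtain ⟨i, hi1, hi2⟩ := exists_shift_phi hq hv
    refine ⟨i, fun k w hw => ?_⟩
    have h1 : ε₁ ≤ phi q c (w + i / q ^ 2 + k / q) := by
      refine le_trans ?_ (abs_sin_le_phi hq c _)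
      have : (q : ℝ) * (w + i / q ^ 2 + k / q + c) = (i / q + q * (w + c)) + k := by
        field_simp
        ring
      rw [this, abs_sin_pi_mul_add_int]
      have h2 := abs_sin_sub_le (Real.pi * (i / q)) (-(Real.pi * (q * (w + c))))
      rw [sub_neg_eq_add, ← mul_add, Real.sin_neg, abs_neg] at h2
      have h3 := abs_sin_sub_le (Real.pi * (q * (w + c))) (Real.pi * (q * (y + c)))
      have h4 := hclose w hw
      linarith
    have h2 : δ / 4 ≤ phi q c (q * (w + i / q ^ 2 + k / q)) := by
      have h3 : (q : ℝ) * (w + i / q ^ 2 + k / q) = (q * w + i / q) + k := by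
        field_simp
      rw [h3, phi_add_int, phi_eq_phi_zero]
      have h4 := abs_phi_sub_phi_le q 0 (q * w + i / q + c) (q * y + c + i / q)
      have h5 : (q : ℝ) * w + i / q + c - (q * y + c + i / q) = q * (w - y) := by ring
      rw [h5, abs_mul, Nat.abs_cast] at h4
      have h6 : 2 * Real.pi * (q : ℝ) ^ 2 * (q * |w - y|) ≤ δ / 4 := by
        refine le_trans ?_ hη2
        have : 2 * Real.pi * (q : ℝ) ^ 2 * (q * |w - y|) = 2 * Real.pi * q ^ 3 * |w - y| := by
          ring
        rw [this]
        gcongr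
      have := (abs_le.1 h4).1
      linarith
    have h3 : orbitProd q c 2 w ≤ q ^ 2 := orbitProd_le q c 2 w
    rw [horb c (w + i / q ^ 2 + k / q)]
    refine le_trans ?_ (mul_le_mul h1 h2 (by positivity) (phi_nonneg _ _ _))
    have h4 : min (ε₁ / q) (ε₁ * (δ / 4) / q ^ 2) * orbitProd q c 2 w ≤
        ε₁ * (δ / 4) / q ^ 2 * q ^ 2 :=
      mul_le_mul (min_le_right _ _) h3 (orbitProd_nonneg _ _ _ _) (by positivity)
    rwa [div_mul_cancel₀ _ (by positivity)] at h4

theorem exists_forall_orbitProd_le (q : ℕ) (c : ℝ) (n : ℕ) :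
    ∃ y, ∀ x, orbitProd q c n x ≤ orbitProd q c n y := by
  obtain ⟨y, -, hy⟩ := isCompact_Icc.exists_isMaxOn (Set.nonempty_Icc.2 zero_le_one)
    (continuous_orbitProd q c n).continuousOn
  refine ⟨y, fun x => ?_⟩
  have h1 : orbitProd q c n x = orbitProd q c n (Int.fract x) := by
    rw [← orbitProd_add_int q c n (Int.fract x) ⌊x⌋, Int.fract_add_floor]
  rw [h1]
  exact hy ⟨Int.fract_nonneg x, (Int.fract_lt_one x).le⟩

/-- Away from the resonant parameters, the maximum of the product along orbit segments of length
`n` is, up to a constant factor, attained on a periodic orbit. -/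
theorem exists_le_beta_of_far {q : ℕ} (hq : 2 ≤ q) {δ : ℝ} (hδ : 0 < δ) :
    ∃ C > 0, ∃ n₀ : ℕ, ∀ c : ℝ, δ ≤ |Real.sin (Real.pi * ((q - 1) * c))| → ∀ n ≥ n₀,
      ∃ b : ℝ, (b : EReal) ≤ beta q c ∧ ∀ x, orbitProd q c n x ≤ C * Real.exp (n * b) := by
  have hq2 : (2 : ℝ) ≤ q := by exact_mod_cast hq
  have hq0 : (q : ℝ) ≠ 0 := by positivity
  have hqpos : (0 : ℝ) < q := by positivity
  obtain ⟨ε, hε, η, hη, hshift⟩ := exists_shift_orbitProd hq hδ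
  have hpi4 : 0 < 1 - Real.pi / 4 := by linarith [Real.pi_lt_four]
  refine ⟨(ε * (1 - Real.pi / 4))⁻¹, by positivity, max 2 ⌈η⁻¹⌉₊, ?_⟩
  intro c hc n hn
  have hn2 : 2 ≤ n := (le_max_left _ _).trans hn
  have hnη : η⁻¹ ≤ n := (Nat.le_ceil _).trans (by exact_mod_cast (le_max_right _ _).trans hn)
  have hn0 : (0 : ℝ) < n := by positivity
  obtain ⟨y, hy⟩ := exists_forall_orbitProd_le q c n
  set M := orbitProd q c n y with hM
  have hMpos : 0 < M := by
    obtain ⟨x, hx⟩ := exists_pow_le_orbitProd hq c n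
    exact lt_of_lt_of_le (by positivity) (hx.trans (hy x))
  obtain ⟨i, hi⟩ := hshift c y hc
  obtain ⟨N, hN⟩ : ∃ N, q ^ n = N + 1 :=
    ⟨q ^ n - 1, (Nat.sub_add_cancel (Nat.one_le_pow _ _ (by omega))).symm⟩
  have hnN : n ≤ N := by
    have := Nat.lt_pow_self (n := n) (a := q) (by omega)
    omega
  have hNn : (n : ℝ) ≤ N := by exact_mod_cast hnN
  have hNpos : (0 : ℝ) < N := hn0.trans_le hNn
  have hqN : (q : ℝ) ^ n = N + 1 := by exact_mod_cast hN
  -- The nearest point to `y` with `q ^ n w ∈ w + i / q ^ 2 + ℤ / q`: these points form a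
  -- progression of step `1 / (q N)`.
  set k : ℤ := round (q * N * y - i / q) with hk
  set w : ℝ := (i / q + k) / (q * N) with hw
  have hwy : q * N * |w - y| ≤ 1 / 2 := by
    have h1 : (q : ℝ) * N * |w - y| = |q * N * y - i / q - k| := by
      rw [← abs_of_pos (by positivity : (0 : ℝ) < q * N), ← abs_mul,
        abs_of_pos (by positivity : (0 : ℝ) < q * N), mul_sub, hw, mul_div_cancel₀ _ (by positivity),
        abs_sub_comm]
      congr 1
      ring
    rw [h1]
    exact abs_sub_round _
  have hwη : |w - y| ≤ η := by
    have h1 : 1 ≤ η * N := by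
      have := (inv_le_iff_one_le_mul₀' hη).1 (hnη.trans hNn)
      linarith
    have h2 : N * |w - y| ≤ 1 := by nlinarith [mul_nonneg hNpos.le (abs_nonneg (w - y))]
    have h3 : N * |w - y| ≤ N * η := by linarith
    exact le_of_mul_le_mul_left h3 hNpos
  -- The distance from `w` to `y` is short enough for the Bernstein bound to be effective.
  have hPw : (1 - Real.pi / 4) * M ≤ orbitProd q c n w := by
    have hbd : ∀ x, ‖sigma q c (N + 1) x‖ ≤ M := by
      intro x
      rw [← hN, norm_sigma_pow hq]
      exact hy x
    have h1 := norm_sigma_sub_le hbd w y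
    rw [← hN, norm_sigma_pow hq, norm_sigma_pow hq, ← hM] at h1
    have h2 : N * |w - y| ≤ 1 / 4 := by nlinarith [mul_nonneg hNpos.le (abs_nonneg (w - y))]
    have h3 : Real.pi * N * M * |w - y| = Real.pi * M * (N * |w - y|) := by ring
    have h4 : Real.pi * M * (N * |w - y|) ≤ Real.pi * M * (1 / 4) := by gcongr
    linarith
  have hPwpos : 0 < orbitProd q c n w := lt_of_lt_of_le (by positivity) hPw
  have hqw : (q : ℝ) ^ n * w = w + i / q ^ 2 + k / q := by
    rw [hqN, hw]
    field_simp
    ring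
  have hP2 : 0 < orbitProd q c 2 w := by
    refine (orbitProd_nonneg _ _ _ _).lt_of_ne fun h0 => hPwpos.ne' ?_
    rw [← Nat.add_sub_cancel' hn2, orbitProd_add, ← h0, zero_mul]
  -- The point `q ^ 2 w` is periodic, and its orbit differs from the orbit segment of `w` only in
  -- that the first two points `w`, `q w` are replaced by those of a good translate.
  have hper : ε * ((1 - Real.pi / 4) * M) ≤ orbitProd q c n (q ^ 2 * w) := by
    have h1 := orbitProd_add q c 2 n w
    rw [add_comm 2 n, orbitProd_add, hqw] at h1
    have h2 : orbitProd q c n w * (ε * orbitProd q c 2 w) ≤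
        orbitProd q c 2 w * orbitProd q c n (q ^ 2 * w) := by
      rw [← h1]
      exact mul_le_mul_of_nonneg_left (hi k w hwη) hPwpos.le
    have h3 : orbitProd q c 2 w * (ε * orbitProd q c n w) ≤
        orbitProd q c 2 w * orbitProd q c n (q ^ 2 * w) := by linarith
    exact le_trans (mul_le_mul_of_nonneg_left hPw hε.le) (le_of_mul_le_mul_left h3 hP2)
  have hpos : 0 < orbitProd q c n (q ^ 2 * w) := lt_of_lt_of_le (by positivity) hper
  have hfix : (q : ℝ) ^ n * (q ^ 2 * w) = q ^ 2 * w + ((i + q * k : ℤ) : ℝ) := by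
    rw [mul_left_comm, hqw]
    push_cast
    field_simp
    ring
  refine ⟨_, le_beta_of_periodic (by omega) hfix hpos, fun x => (hy x).trans ?_⟩
  rw [mul_div_cancel₀ _ hn0.ne', Real.exp_log hpos, inv_mul_eq_div, le_div_iff₀ (by positivity)]
  linarith

/-! ### Domination by a fixed point, for `(q - 1) c` close to an integer -/

/-- The Dirichlet-type kernel `sin (π q t) / sin (π t)`, as a sum of cosines. -/
def dirichletCos (q : ℕ) (t : ℝ) : ℝ :=
  ∑ j ∈ Finset.range q, Real.cos (Real.pi * (q - 1 - 2 * j) * t)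

/-- The derivative of `dirichletCos`. -/
def dirichletCosDeriv (q : ℕ) (t : ℝ) : ℝ :=
  ∑ j ∈ Finset.range q,
    -(Real.pi * (q - 1 - 2 * j) * Real.sin (Real.pi * (q - 1 - 2 * j) * t))

theorem dirichletCos_mul_sin (q : ℕ) (t : ℝ) :
    dirichletCos q t * Real.sin (Real.pi * t) = Real.sin (Real.pi * q * t) := by
  have h : ∀ j ∈ Finset.range q,
      Real.cos (Real.pi * (q - 1 - 2 * j) * t) * Real.sin (Real.pi * t) =
        (Real.sin (Real.pi * (q - 2 * j) * t) -
          Real.sin (Real.pi * (q - 2 * (j + 1 : ℕ)) * t)) / 2 := by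
    intro j _
    have h1 : Real.pi * ((q : ℝ) - 2 * j) * t =
        Real.pi * (q - 1 - 2 * j) * t + Real.pi * t := by ring
    have h2 : Real.pi * ((q : ℝ) - 2 * (j + 1 : ℕ)) * t =
        Real.pi * (q - 1 - 2 * j) * t - Real.pi * t := by push_cast; ring
    rw [h1, h2, Real.sin_add, Real.sin_sub]
    ring
  rw [dirichletCos, Finset.sum_mul, Finset.sum_congr rfl h, ← Finset.sum_div,
    Finset.sum_range_sub' fun j : ℕ => Real.sin (Real.pi * (q - 2 * j) * t)]
  have h3 : Real.pi * ((q : ℝ) - 2 * q) * t = -(Real.pi * q * t) := by ring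
  rw [h3, Real.sin_neg, Nat.cast_zero, mul_zero, sub_zero]
  ring

theorem phi_zero_eq_abs_dirichletCos (q : ℕ) {t : ℝ} (ht : |t| < 1) :
    phi q 0 t = |dirichletCos q t| := by
  unfold phi
  rw [add_zero]
  split_ifs with h
  · have ht0 : t = 0 := by
      rw [abs_lt] at ht
      have h1 := (Real.sin_eq_zero_iff_of_lt_of_lt (x := Real.pi * t)
        (by nlinarith [Real.pi_pos]) (by nlinarith [Real.pi_pos])).1 h
      exact (mul_eq_zero.1 h1).resolve_left Real.pi_ne_zero
    simp [ht0, dirichletCos]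
  · rw [← dirichletCos_mul_sin, mul_div_cancel_right₀ _ h]

theorem abs_freq_le {q j : ℕ} (hj : j ∈ Finset.range q) : |(q : ℝ) - 1 - 2 * j| ≤ q - 1 := by
  have h1 : (j : ℝ) + 1 ≤ q := by exact_mod_cast Finset.mem_range.1 hj
  have h2 : (0 : ℝ) ≤ j := by positivity
  exact abs_le.2 ⟨by linarith, by linarith⟩

theorem cos_add_le_tangent {a h : ℝ} (ha : |a| ≤ Real.pi / 2) (hah : |a + h| ≤ Real.pi / 2) :
    Real.cos (a + h) ≤ Real.cos a - Real.sin a * h := by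
  have hcos : ConcaveOn ℝ (Set.Icc (-(Real.pi / 2)) (Real.pi / 2)) Real.cos :=
    strictConcaveOn_cos_Icc.concaveOn
  have ham := abs_le.1 ha
  have hahm := abs_le.1 hah
  rcases lt_trichotomy h 0 with hh | hh | hh
  · have := hcos.deriv_le_slope (x := a + h) (y := a) hahm ham (by linarith)
      Real.differentiableAt_cos
    rw [Real.deriv_cos, slope_def_field, le_div_iff₀ (by linarith)] at this
    linarith
  · simp [hh]
  · have := hcos.slope_le_deriv (x := a) (y := a + h) ham hahm (by linarith)
      Real.differentiableAt_cos
    rw [Real.deriv_cos, slope_def_field, div_le_iff₀ (by linarith)] at this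
    linarith

/-- In the main lobe the kernel lies below its tangents. -/
theorem dirichletCos_add_le {q : ℕ} {e s : ℝ} (he : (q - 1) * |e| ≤ 1 / 2)
    (hes : (q - 1) * |e + s| ≤ 1 / 2) :
    dirichletCos q (e + s) ≤ dirichletCos q e + dirichletCosDeriv q e * s := by
  have hb : ∀ j ∈ Finset.range q, ∀ u : ℝ, ((q : ℝ) - 1) * |u| ≤ 1 / 2 →
      |Real.pi * (q - 1 - 2 * j) * u| ≤ Real.pi / 2 := by
    intro j hj u hu
    rw [abs_mul, abs_mul, abs_of_pos Real.pi_pos, mul_assoc, div_eq_mul_one_div]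
    refine mul_le_mul_of_nonneg_left (le_trans ?_ hu) Real.pi_pos.le
    exact mul_le_mul_of_nonneg_right (abs_freq_le hj) (abs_nonneg u)
  rw [dirichletCos, dirichletCos, dirichletCosDeriv, Finset.sum_mul, ← Finset.sum_add_distrib]
  refine Finset.sum_le_sum fun j hj => ?_
  have h1 := hb j hj _ hes
  rw [mul_add] at h1 ⊢
  have h2 := cos_add_le_tangent (hb j hj _ he) h1
  linarith

theorem dirichletCos_nonneg {q : ℕ} {t : ℝ} (ht : (q - 1) * |t| ≤ 1 / 2) :
    0 ≤ dirichletCos q t := by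
  refine Finset.sum_nonneg fun j hj => ?_
  have h : |Real.pi * (q - 1 - 2 * j) * t| ≤ Real.pi / 2 := by
    rw [abs_mul, abs_mul, abs_of_pos Real.pi_pos, mul_assoc, div_eq_mul_one_div]
    refine mul_le_mul_of_nonneg_left (le_trans ?_ ht) Real.pi_pos.le
    exact mul_le_mul_of_nonneg_right (abs_freq_le hj) (abs_nonneg t)
  exact Real.cos_nonneg_of_neg_pi_div_two_le_of_le (abs_le.1 h).1 (abs_le.1 h).2

/-- Only the first two terms of the geometric sum are compared with each other. -/
theorem phi_zero_le_of_far {q : ℕ} (hq : 2 ≤ q) {r t : ℝ} (hr : 0 ≤ r) (hrt : r ≤ |t|)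
    (htr : |t| ≤ 1 - r) : phi q 0 t ≤ q - 2 + 2 * Real.cos (Real.pi * r) := by
  obtain ⟨m, rfl⟩ : ∃ m, q = m + 2 := ⟨q - 2, by omega⟩
  rw [← norm_sum_expTwoPi, Finset.sum_range_succ', Finset.sum_range_succ', add_assoc]
  have h1 : ‖∑ k ∈ Finset.range m, expTwoPi (((k + 1 + 1 : ℕ) : ℝ) * (t + 0))‖ ≤ m := by
    refine (norm_sum_le _ _).trans ?_
    simp
  have h2 : ‖expTwoPi (((0 + 1 : ℕ) : ℝ) * (t + 0)) + expTwoPi (((0 : ℕ) : ℝ) * (t + 0))‖ =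
      2 * |Real.cos (Real.pi * t)| := by
    have h3 := norm_expTwoPi_sub_one (t + 1 / 2)
    have h4 : expTwoPi (1 / 2) = -1 := by
      rw [expTwoPi, ← Complex.exp_pi_mul_I]
      congr 1
      push_cast
      ring
    have h5 : Real.pi * (t + 1 / 2) = Real.pi * t + Real.pi / 2 := by ring
    rw [expTwoPi_add, h4, h5, Real.sin_add_pi_div_two] at h3
    rw [← h3, ← norm_neg]
    have h6 : expTwoPi (((0 : ℕ) : ℝ) * (t + 0)) = 1 := by simp [expTwoPi]
    rw [h6]
    congr 1
    simp only [zero_add, Nat.cast_one, one_mul, add_zero]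
    ring
  have h3 : |Real.cos (Real.pi * t)| ≤ Real.cos (Real.pi * r) := by
    have hpi := Real.pi_pos
    rw [← Real.cos_abs (Real.pi * t), abs_mul, abs_of_pos hpi]
    refine abs_le.2 ⟨?_, ?_⟩
    · rw [← Real.cos_pi_sub]
      refine Real.cos_le_cos_of_nonneg_of_le_pi (by positivity) ?_ ?_
      · nlinarith
      · nlinarith
    · refine Real.cos_le_cos_of_nonneg_of_le_pi (by positivity) ?_ ?_
      · nlinarith
      · gcongr
  refine (norm_add_le _ _).trans ?_
  rw [h2, Nat.cast_add, Nat.cast_ofNat]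
  linarith

theorem continuous_dirichletCos (q : ℕ) : Continuous (dirichletCos q) := by
  unfold dirichletCos; fun_prop

theorem continuous_dirichletCosDeriv (q : ℕ) : Continuous (dirichletCosDeriv q) := by
  unfold dirichletCosDeriv; fun_prop

/-- For a fixed point `e` of `t ↦ q t - (q - 1) e` close to the maximum `0` of `φ_0`, the
function `log φ_0(e + s) - log φ_0(e)` is dominated by the coboundary of the sawtooth function
`κ (s - round s)`. The slope `κ` is dictated by the derivative at `s = 0`. -/
theorem exists_phi_add_le_mul_exp {q : ℕ} (hq : 2 ≤ q) :
    ∃ δ > 0, ∀ e : ℝ, |e| ≤ δ → 0 < phi q 0 e ∧ ∃ κ : ℝ, |κ| ≤ 1 ∧ ∀ s : ℝ,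
      phi q 0 (e + s) ≤
        phi q 0 e * Real.exp (κ * ((q * s - round (q * s)) - (s - round s))) := by
  have hq2 : (2 : ℝ) ≤ q := by exact_mod_cast hq
  have hqpos : (0 : ℝ) < q := by positivity
  have hq1 : (0 : ℝ) < q - 1 := by linarith
  have hpi := Real.pi_pos
  have hD0 : dirichletCos q 0 = q := by simp [dirichletCos]
  have hD0' : dirichletCosDeriv q 0 = 0 := by simp [dirichletCosDeriv]
  have hDc := continuous_dirichletCos q
  have hDc' := continuous_dirichletCosDeriv q
  set κ : ℝ → ℝ := fun e => dirichletCosDeriv q e / ((q - 1) * dirichletCos q e) with hκ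
  have hκ0 : κ 0 = 0 := by simp [hκ, hD0']
  have hκc : ContinuousAt κ 0 := by
    refine hDc'.continuousAt.div (continuous_const.mul hDc).continuousAt ?_
    rw [hD0]
    positivity
  have hcos : Real.cos (Real.pi * (1 / (4 * q))) < 1 := by
    have h1 : 0 < 1 / (4 * (q : ℝ)) := by positivity
    have h2 : 1 / (4 * (q : ℝ)) ≤ 1 := by
      rw [div_le_one (by positivity)]; linarith
    have h3 := Real.cos_lt_cos_of_nonneg_of_le_pi (x := 0) (y := Real.pi * (1 / (4 * q))) le_rfl
      (mul_le_of_le_one_right hpi.le h2) (by positivity)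
    rwa [Real.cos_zero] at h3
  have hev : ∀ᶠ e in nhds (0 : ℝ), 0 < dirichletCos q e ∧ |κ e| ≤ 1 ∧
      (q : ℝ) - 2 + 2 * Real.cos (Real.pi * (1 / (4 * q))) <
        dirichletCos q e * Real.exp (-|κ e|) ∧ |e| < 1 / (4 * q) ∧
      |e| < 1 / (2 * (q - 1)) - 1 / (2 * q) := by
    refine Filter.Eventually.and ?_ (Filter.Eventually.and ?_ (Filter.Eventually.and ?_
      (Filter.Eventually.and ?_ ?_)))
    · refine hDc.continuousAt.eventually (lt_mem_nhds ?_)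
      rw [hD0]; exact hqpos
    · have h : ∀ᶠ e in nhds (0 : ℝ), |κ e| < 1 := by
        refine hκc.abs.eventually (gt_mem_nhds ?_)
        simp only [hκ0, abs_zero]; exact one_pos
      exact h.mono fun _ h => h.le
    · have hc : ContinuousAt (fun e => dirichletCos q e * Real.exp (-|κ e|)) 0 :=
        hDc.continuousAt.mul hκc.abs.neg.rexp
      refine hc.eventually (lt_mem_nhds ?_)
      simp only [hD0, hκ0, abs_zero, neg_zero, Real.exp_zero]
      linarith
    · refine continuous_abs.continuousAt.eventually (gt_mem_nhds ?_)
      rw [abs_zero]; positivity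
    · refine continuous_abs.continuousAt.eventually (gt_mem_nhds ?_)
      rw [abs_zero, sub_pos]
      exact one_div_lt_one_div_of_lt (by positivity) (by linarith)
  obtain ⟨δ, hδ, hball⟩ := Metric.eventually_nhds_iff.1 hev
  refine ⟨δ / 2, by positivity, fun e he => ?_⟩
  obtain ⟨hD, hκ1, hfar, he4, he2⟩ := hball (y := e) (by
    rw [Real.dist_eq, sub_zero]; linarith)
  have hq4 : 1 / (4 * (q : ℝ)) ≤ 1 / 8 := by
    apply one_div_le_one_div_of_le <;> linarith
  have hphie : phi q 0 e = dirichletCos q e := by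
    rw [phi_zero_eq_abs_dirichletCos q (by linarith), abs_of_pos hD]
  rw [hphie]
  refine ⟨hD, κ e, hκ1, fun s => ?_⟩
  -- Reduction to `|s| ≤ 1 / 2`.
  wlog hs : round s = 0 generalizing s with H
  · have h1 := H (s - round s) (by rw [round_sub_intCast, sub_self])
    have h2 : phi q 0 (e + (s - round s)) = phi q 0 (e + s) := by
      rw [← phi_add_int q 0 (e + (s - round s)) (round s)]
      congr 1
      ring
    have h3 : (q : ℝ) * (s - round s) = q * s - ((q * round s : ℤ) : ℝ) := by
      push_cast; ring
    rw [h2, h3, round_sub_intCast, round_sub_intCast] at h1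
    push_cast at h1
    simpa using h1
  have hs2 : |s| ≤ 1 / 2 := by
    have := abs_sub_round s
    rwa [hs, Int.cast_zero, sub_zero] at this
  rw [hs, Int.cast_zero, sub_zero]
  by_cases hsq : q * |s| < 1 / 2
  · have hround : round (q * s) = 0 := by
      rw [round_eq_zero_iff]
      rw [← abs_of_pos hqpos, ← abs_mul, abs_lt] at hsq
      exact ⟨hsq.1.le, hsq.2⟩
    rw [hround, Int.cast_zero, sub_zero]
    have hs' : |s| < 1 / (2 * q) := by
      rw [lt_div_iff₀ (by positivity)]; linarith
    have hmul : ∀ u : ℝ, |u| < 1 / (2 * (q - 1)) → ((q : ℝ) - 1) * |u| ≤ 1 / 2 := by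
      intro u hu
      rw [lt_div_iff₀ (by positivity)] at hu
      linarith
    have hes : |e + s| < 1 / (2 * ((q : ℝ) - 1)) := by
      linarith [abs_add_le e s]
    have he' : |e| < 1 / (2 * ((q : ℝ) - 1)) := by
      have : 0 < 1 / (2 * (q : ℝ)) := by positivity
      linarith
    have hes1 : |e + s| < 1 := by linarith [abs_add_le e s]
    rw [phi_zero_eq_abs_dirichletCos q hes1, abs_of_nonneg (dirichletCos_nonneg (hmul _ hes))]
    refine (dirichletCos_add_le (hmul _ he') (hmul _ hes)).trans ?_
    have h1 : dirichletCos q e + dirichletCosDeriv q e * s =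
        dirichletCos q e * (κ e * (q * s - s) + 1) := by
      have hD' := hD.ne'
      have hq1' := hq1.ne'
      simp only [hκ]
      field_simp
      ring
    rw [h1]
    exact mul_le_mul_of_nonneg_left (Real.add_one_le_exp _) hD.le
  · push Not at hsq
    have hs' : 1 / (2 * (q : ℝ)) ≤ |s| := by
      rw [div_le_iff₀ (by positivity)]; linarith
    have h42 : 1 / (2 * (q : ℝ)) = 2 * (1 / (4 * q)) := by
      field_simp
      norm_num
    have hlow : 1 / (4 * (q : ℝ)) ≤ |e + s| := by
      have := abs_sub_abs_le_abs_sub s (-e)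
      rw [abs_neg, sub_neg_eq_add, add_comm s e] at this
      linarith
    have hhigh : |e + s| ≤ 1 - 1 / (4 * (q : ℝ)) := by
      linarith [abs_add_le e s]
    refine (phi_zero_le_of_far hq (by positivity) hlow hhigh).trans (hfar.le.trans ?_)
    refine mul_le_mul_of_nonneg_left (Real.exp_le_exp.2 ?_) hD.le
    have h1 : |q * s - round (q * s) - s| ≤ 1 := by
      refine (abs_sub _ _).trans ?_
      linarith [abs_sub_round ((q : ℝ) * s)]
    have h2 : |κ e * (q * s - round (q * s) - s)| ≤ |κ e| := by
      rw [abs_mul]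
      exact mul_le_of_le_one_right (abs_nonneg _) h1
    exact (abs_le.1 h2).1.trans' (by linarith)

/-- Near the resonant parameters a fixed point of `x ↦ q x` is maximizing. -/
theorem exists_le_beta_of_near {q : ℕ} (hq : 2 ≤ q) :
    ∃ δ > 0, ∀ c : ℝ, |Real.sin (Real.pi * ((q - 1) * c))| < δ →
      ∃ b : ℝ, (b : EReal) ≤ beta q c ∧
        ∀ (n : ℕ) (x : ℝ), orbitProd q c n x ≤ Real.exp 1 * Real.exp (n * b) := by
  have hq2 : (2 : ℝ) ≤ q := by exact_mod_cast hq
  have hq1 : (0 : ℝ) < q - 1 := by linarith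
  obtain ⟨δ, hδ, hstep⟩ := exists_phi_add_le_mul_exp hq
  refine ⟨2 * δ, by positivity, fun c hc => ?_⟩
  set k : ℤ := round ((q - 1) * c) with hk
  set e : ℝ := ((q - 1) * c - k) / (q - 1) with he
  have hce : (q - 1) * (c - e) = k := by
    rw [he, mul_sub, mul_div_cancel₀ _ hq1.ne']; ring
  have heδ : |e| ≤ δ := by
    have h1 := abs_sin_pi_mul_add_int ((q - 1) * c - k) k
    rw [sub_add_cancel] at h1
    have h2 := two_mul_abs_le_abs_sin (abs_sub_round (((q : ℝ) - 1) * c))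
    rw [← hk, ← h1] at h2
    rw [he, abs_div, abs_of_pos hq1, div_le_iff₀ hq1]
    nlinarith
  obtain ⟨hpos, κ, hκ, hphi⟩ := hstep e heδ
  refine ⟨Real.log (phi q 0 e), ?_, ?_⟩
  · have hfix : (q : ℝ) ^ 1 * (-(c - e)) = -(c - e) + ((-k : ℤ) : ℝ) := by
      push_cast
      linarith
    have hval : orbitProd q c 1 (-(c - e)) = phi q 0 e := by
      rw [orbitProd_one, phi_eq_phi_zero]
      congr 1
      ring
    have h := le_beta_of_periodic le_rfl hfix (by rwa [hval])
    rwa [hval, Nat.cast_one, div_one] at h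
  · set u : ℝ → ℝ := fun s => s - round s with hu
    have key : ∀ (n : ℕ) (x : ℝ), orbitProd q c n x ≤
        phi q 0 e ^ n * Real.exp (κ * (u (q ^ n * x + (c - e)) - u (x + (c - e)))) := by
      intro n
      induction n with
      | zero => intro x; simp
      | succ n ih =>
        intro x
        have h1 := hphi (q ^ n * x + (c - e))
        have h2 : e + (q ^ n * x + (c - e)) = q ^ n * x + c := by ring
        have h3 : (q : ℝ) * (q ^ n * x + (c - e)) = (q ^ (n + 1) * x + (c - e)) + k := by
          rw [← hce]; ring
        have h4 : (q : ℝ) ^ (n + 1) * x + (c - e) + k -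
            ((round (q ^ (n + 1) * x + (c - e)) + k : ℤ) : ℝ) = u (q ^ (n + 1) * x + (c - e)) := by
          simp only [hu]
          push_cast
          ring
        rw [h2, h3, round_add_intCast, h4, ← phi_eq_phi_zero] at h1
        rw [orbitProd_add, orbitProd_one]
        refine (mul_le_mul (ih x) h1 (phi_nonneg _ _ _) (by positivity)).trans ?_
        rw [pow_succ, mul_mul_mul_comm, ← Real.exp_add]
        refine le_of_eq ?_
        congr 2
        simp only [hu]
        ring
    intro n x
    refine (key n x).trans ?_
    rw [mul_comm, Real.exp_nat_mul, Real.exp_log hpos]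
    refine mul_le_mul_of_nonneg_right (Real.exp_le_exp.2 ?_) (by positivity)
    have h1 : |u (q ^ n * x + (c - e)) - u (x + (c - e))| ≤ 1 := by
      refine (abs_sub _ _).trans ?_
      have h1 := abs_sub_round ((q : ℝ) ^ n * x + (c - e))
      have h2 := abs_sub_round (x + (c - e))
      simp only [hu]
      linarith
    refine (le_abs_self _).trans ?_
    rw [abs_mul]
    exact mul_le_one₀ hκ (abs_nonneg _) h1

/-! ### The Gelfond exponent -/

theorem le_of_forall_nat_mul_le {a b K : ℝ} {n₀ : ℕ}
    (h : ∀ n : ℕ, n₀ ≤ n → (n : ℝ) * a ≤ K + n * b) : a ≤ b := by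
  by_contra! hab
  obtain ⟨m, hm⟩ := exists_nat_gt (K / (a - b))
  have hpos : 0 < a - b := sub_pos.2 hab
  have h1 := h (max n₀ m) (le_max_left _ _)
  have h2 : (m : ℝ) ≤ (max n₀ m : ℕ) := by exact_mod_cast le_max_right _ _
  rw [div_lt_iff₀ hpos] at hm
  nlinarith

/-- The product along orbits grows at most like `exp (n β(c))`, uniformly in `c`. -/
theorem exists_orbitProd_le_exp_beta {q : ℕ} (hq : 2 ≤ q) :
    ∃ C > 0, ∀ c : ℝ, ∃ b : ℝ, beta q c = b ∧ Real.log (4 / Real.pi) ≤ b ∧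
      ∀ (n : ℕ) (x : ℝ), orbitProd q c n x ≤ C * Real.exp (n * b) := by
  obtain ⟨δ, hδ, hnear⟩ := exists_le_beta_of_near hq
  obtain ⟨C, hC, n₀, hfar⟩ := exists_le_beta_of_far hq hδ
  have hq1 : (1 : ℝ) ≤ q := by exact_mod_cast (by omega : 1 ≤ q)
  have hkey : ∀ (c : ℝ) (n : ℕ), n₀ ≤ n → ∃ b : ℝ, (b : EReal) ≤ beta q c ∧
      ∀ x, orbitProd q c n x ≤ (C + Real.exp 1) * Real.exp (n * b) := by
    intro c n hn
    rcases lt_or_ge |Real.sin (Real.pi * ((q - 1) * c))| δ with h | h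
    · obtain ⟨b, hb, hbx⟩ := hnear c h
      refine ⟨b, hb, fun x => (hbx n x).trans ?_⟩
      gcongr
      linarith
    · obtain ⟨b, hb, hbx⟩ := hfar c h n hn
      refine ⟨b, hb, fun x => (hbx x).trans ?_⟩
      gcongr
      linarith [Real.exp_pos 1]
  refine ⟨C + Real.exp 1 + q ^ n₀, by positivity, fun c => ?_⟩
  have hbot : beta q c ≠ ⊥ := by
    obtain ⟨b, hb, -⟩ := hkey c n₀ le_rfl
    intro h
    rw [h, le_bot_iff] at hb
    exact EReal.coe_ne_bot b hb
  have htop : beta q c ≠ ⊤ := by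
    have h := beta_le (q := q) (c := c) le_rfl (orbitProd_le q c 1)
    intro h'
    rw [h', top_le_iff] at h
    exact EReal.coe_ne_top _ h
  obtain ⟨b, hb⟩ : ∃ b : ℝ, beta q c = b := ⟨_, (EReal.coe_toReal htop hbot).symm⟩
  have hle : ∀ n, n₀ ≤ n → ∀ x, orbitProd q c n x ≤ (C + Real.exp 1) * Real.exp (n * b) := by
    intro n hn x
    obtain ⟨b', hb', hx⟩ := hkey c n hn
    rw [hb, EReal.coe_le_coe_iff] at hb'
    refine (hx x).trans ?_
    gcongr
  have hlow : Real.log (4 / Real.pi) ≤ b := by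
    refine le_of_forall_nat_mul_le (K := Real.log (C + Real.exp 1)) (n₀ := n₀) fun n hn => ?_
    obtain ⟨x, hx⟩ := exists_pow_le_orbitProd hq c n
    have h := Real.log_le_log (by positivity) (hx.trans (hle n hn x))
    rwa [Real.log_pow, Real.log_mul (by positivity) (by positivity), Real.log_exp] at h
  refine ⟨b, hb, hlow, fun n x => ?_⟩
  have hb0 : 0 ≤ b := hlow.trans' (Real.log_nonneg (by
    rw [one_le_div Real.pi_pos]; exact Real.pi_le_four))
  rcases le_or_gt n₀ n with hn | hn
  · refine (hle n hn x).trans ?_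
    refine mul_le_mul_of_nonneg_right ?_ (Real.exp_pos _).le
    exact le_add_of_nonneg_right (by positivity)
  · refine (orbitProd_le q c n x).trans ?_
    have h1 : (q : ℝ) ^ n ≤ q ^ n₀ := pow_le_pow_right₀ hq1 hn.le
    have h2 : (1 : ℝ) ≤ Real.exp (n * b) := Real.one_le_exp (by positivity)
    have h3 : (q : ℝ) ^ n₀ ≤ C + Real.exp 1 + q ^ n₀ := le_add_of_nonneg_left (by positivity)
    calc (q : ℝ) ^ n ≤ (C + Real.exp 1 + q ^ n₀) * 1 := by linarith
      _ ≤ _ := by gcongr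

theorem sum_pow_le_five_mul {r : ℝ} (hr : 5 / 4 ≤ r) (m : ℕ) :
    ∑ k ∈ Finset.range (m + 1), r ^ k ≤ 5 * r ^ m := by
  induction m with
  | zero => simp
  | succ m ih =>
    rw [Finset.sum_range_succ, pow_succ]
    have : 0 < r ^ m := by positivity
    nlinarith

/-- The uniform bound for `σ_N`, with the constant independent of `c`. The sum over the scales
`q ^ k ≤ N` is geometric with ratio `exp β(c) ≥ 4 / π`, uniformly away from `1`. -/
theorem exists_norm_sigma_le_rpow_beta {q : ℕ} (hq : 2 ≤ q) :
    ∃ C > 0, ∀ c : ℝ, ∃ b : ℝ, beta q c = b ∧ ∀ (x : ℝ) (N : ℕ), 1 ≤ N →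
      ‖sigma q c N x‖ ≤ C * (N : ℝ) ^ (b / Real.log q) := by
  obtain ⟨C, hC, h⟩ := exists_orbitProd_le_exp_beta hq
  have hqpos : (0 : ℝ) < q := by positivity
  have hlogq : 0 < Real.log q := Real.log_pos (by exact_mod_cast (by omega : 1 < q))
  refine ⟨5 * q * C, by positivity, fun c => ?_⟩
  obtain ⟨b, hb, hlow, hle⟩ := h c
  refine ⟨b, hb, fun x N hN => ?_⟩
  have hb0 : 0 ≤ b := hlow.trans' (Real.log_nonneg (by
    rw [one_le_div Real.pi_pos]; exact Real.pi_le_four))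
  have hr : 5 / 4 ≤ Real.exp b := by
    refine le_trans ?_ ((Real.log_le_iff_le_exp (by positivity)).1 hlow)
    rw [div_le_div_iff₀ (by norm_num) Real.pi_pos]
    linarith [Real.pi_lt_d2]
  set m := Nat.log q N with hm
  have hsum : ∑ k ∈ Finset.range (m + 1), orbitProd q c k x ≤ C * (5 * Real.exp b ^ m) := by
    refine le_trans ?_ (mul_le_mul_of_nonneg_left (sum_pow_le_five_mul hr m) hC.le)
    rw [Finset.mul_sum]
    refine Finset.sum_le_sum fun k _ => ?_
    rw [← Real.exp_nat_mul]
    exact hle k x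
  have hpow : Real.exp b ^ m ≤ (N : ℝ) ^ (b / Real.log q) := by
    have h1 : Real.exp b ^ m = ((q : ℝ) ^ m) ^ (b / Real.log q) := by
      rw [← Real.rpow_natCast_mul hqpos.le, Real.rpow_def_of_pos hqpos, ← Real.exp_nat_mul]
      congr 1
      field_simp
    rw [h1]
    refine Real.rpow_le_rpow (by positivity) ?_ (by positivity)
    exact_mod_cast Nat.pow_log_le_self q (by omega)
  refine (norm_sigma_le_sum_orbitProd hq c (m + 1) x (Nat.lt_pow_succ_log_self hq N)).trans ?_
  calc (q : ℝ) * ∑ k ∈ Finset.range (m + 1), orbitProd q c k x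
      ≤ q * (C * (5 * Real.exp b ^ m)) := by gcongr
    _ = 5 * q * C * Real.exp b ^ m := by ring
    _ ≤ _ := by gcongr

theorem norm_sigma_le_natCast (q : ℕ) (c : ℝ) (N : ℕ) (x : ℝ) : ‖sigma q c N x‖ ≤ N := by
  rw [sigma_eq]
  refine (norm_sum_le _ _).trans ?_
  simp

theorem bddAbove_range_norm_sigma (q : ℕ) (c : ℝ) (N : ℕ) :
    BddAbove (Set.range fun x : ℝ => ‖sigma q c N x‖) :=
  ⟨N, by rintro _ ⟨x, rfl⟩; exact norm_sigma_le_natCast q c N x⟩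

/-- The bound with exponent `β(c) / log q` is optimal: a smaller exponent at the scales
`N = q ^ n` would contradict `beta_le`. -/
theorem gelfondExponent_eq {q : ℕ} (hq : 2 ≤ q) {c b C : ℝ} (hb : beta q c = b)
    (hC : ∀ (x : ℝ) (N : ℕ), 1 ≤ N → ‖sigma q c N x‖ ≤ C * (N : ℝ) ^ (b / Real.log q)) :
    gelfondExponent q c = b / Real.log q := by
  have hqpos : (0 : ℝ) < q := by positivity
  have hlogq : 0 < Real.log q := Real.log_pos (by exact_mod_cast (by omega : 1 < q))
  refine IsLeast.csInf_eq ⟨?_, ?_⟩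
  · refine Asymptotics.IsBigO.of_bound C ?_
    filter_upwards [eventually_ge_atTop 1] with N hN
    rw [Real.norm_of_nonneg (Real.iSup_nonneg fun x => norm_nonneg _),
      Real.norm_of_nonneg (by positivity)]
    exact ciSup_le fun x => hC x N hN
  · intro γ hγ
    obtain ⟨K, hK, hO⟩ := Asymptotics.IsBigO.exists_pos hγ
    obtain ⟨N₀, hN₀⟩ := eventually_atTop.1 hO.bound
    rw [div_le_iff₀ hlogq]
    refine le_of_forall_nat_mul_le (K := Real.log K) (n₀ := max N₀ 1) fun n hn => ?_
    have hn1 : 1 ≤ n := (le_max_right _ _).trans hn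
    have hn0 : (0 : ℝ) < n := by exact_mod_cast hn1
    have hN : N₀ ≤ q ^ n :=
      ((le_max_left _ _).trans hn).trans (Nat.lt_pow_self (by omega)).le
    have hle : ∀ x, orbitProd q c n x ≤ K * ((q : ℝ) ^ n) ^ γ := by
      intro x
      have h1 := hN₀ _ hN
      rw [Real.norm_of_nonneg (Real.iSup_nonneg fun x => norm_nonneg _),
        Real.norm_of_nonneg (by positivity)] at h1
      have h2 := le_ciSup (bddAbove_range_norm_sigma q c (q ^ n)) x
      rw [norm_sigma_pow hq] at h2
      push_cast at h1
      exact h2.trans h1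
    have h := beta_le hn1 hle
    rw [hb, EReal.coe_le_coe_iff, le_div_iff₀ hn0,
      Real.log_mul hK.ne' (by positivity), Real.log_rpow (by positivity), Real.log_pow] at h
    linarith

end ThueMorse

end

theorem mainTheorem3 (q : ℕ) (hq : 2 ≤ q) :
    (∀ c : ℝ, (ThueMorse.gelfondExponent q c : EReal)
        = ThueMorse.beta q c / ((Real.log q : ℝ) : EReal)) ∧
    ∃ C : ℝ, 0 < C ∧ ∀ c x : ℝ, ∀ N : ℕ, 1 ≤ N →
      ‖ThueMorse.sigma q c N x‖ ≤ C * (N : ℝ) ^ ThueMorse.gelfondExponent q c := by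
  obtain ⟨C, hC, h⟩ := ThueMorse.exists_norm_sigma_le_rpow_beta hq
  refine ⟨fun c => ?_, C, hC, fun c x N hN => ?_⟩
  · obtain ⟨b, hb, hle⟩ := h c
    rw [ThueMorse.gelfondExponent_eq hq hb hle, hb, EReal.coe_div]
  · obtain ⟨b, hb, hle⟩ := h c
    rw [ThueMorse.gelfondExponent_eq hq hb hle]
    exact hle x N hN
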